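/- Let $n\ge 1$ and let $a,b,c$ be real numbers with $c\neq 0$. Consider the Brusselator system $$v_t=\Delta v+v^2w-(b+1)v+a,\qquad w_t=c\,\Delta w-v^2w+bv,\qquad \Delta=\sum_{i=1}^n\frac{\partial^2}{\partial x_i^2}.$$ Write $u^1=v$, $u^2=w$, and let $\mathcal F$ be the algebra of smooth functions of $t,x_1,\dots,x_n$ and the space derivatives $u^k_I=\partial^{|I|}u^k/\partial x^I$ ($k=1,2$, $I\in\mathbb Z_{\ge0}^n$), each function depending on finitely many of these variables. Let $F^1,F^2\in\mathcal F$ be the right-hand sides of the system and let $$D_{x_i}=\frac{\partial}{\partial x_i}+\sum_{k,I}u^k_{I+1_i}\frac{\partial}{\partial u^k_I},\qquad D_t=\frac{\partial}{\partial t}+\sum_{k,I}D_x^I(F^k)\frac{\partial}{\partial u^k_I}$$ be the total derivatives on the system. A conserved current is a tuple $J=(J_0,\dots,J_n)$ of elements of $\mathcal F$ with $D_tJ_0+\sum_iD_{x_i}J_i=0$; with $D_0=D_t$ and $D_i=D_{x_i}$, it is trivial if $J_k=\sum_{l<k}D_l(L_{lk})-\sum_{k<l}D_l(L_{kl})$ for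 some $L_{kl}\in\mathcal F$ ($0\le k<l\le n$). Two currents are equivalent if they differ by a trivial one, and conservation laws are the equivalence classes of conserved currents. The characteristic of $J$ is $\chi=(\chi_1,\chi_2)$, where $\chi_k=\sum_I(-1)^{|I|}D_x^I\bigl(\partial J_0/\partial u^k_I\bigr)$. (1) Let $c\ne1$. For each smooth function $G(x_1,\dots,x_n)$ with $G+(c-1)\Delta G=0$ and any smooth antiderivatives $\int G\,dx_i$ of $G$ in the variables $x_i$ (these exist), the tuple $$J_0=G\,e^{\frac{ct}{c-1}}(v+w),\qquad J_i=e^{\frac{ct}{c-1}}\Bigl(\frac{\partial G}{\partial x_i}(v+cw)-G\,(v_{x_i}+c\,w_{x_i})-\frac an\int G\,dx_i\Bigr),\quad i=1,\dots,n,$$ is a conserved current with characteristic $\chi_1=\chi_2=G\,e^{\frac{ct}{c-1}}$. These currents span the space of conservation laws: for each conserved current $J$ there is a smooth $G$ with $G+(c-1)\Delta G=0$ such that the characteristic of $J$ is $\chi_1=\chi_2=G\,e^{\frac{ct}{c-1}}$ and $J$ is equivalent to the conserved current above built from $G$, for any choice of the antiderivatives. (2) If $c=1$, there are no nontrivial conservation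 laws: every conserved current is trivial. -/

import Mathlib

open scoped ContDiff

noncomputable section

namespace Brusselator

/-- Coordinates on the infinitely prolonged equation of a first order evolution system
`∂u^k/∂t = F^k` with `n` space variables and `m` unknown functions: the time `t`, the space
variables `x i`, and the space derivatives `u k I = ∂^{|I|} u^k / ∂x^I`, for `I` a multi-index. All
`t`-derivatives are expressed through these by means of the system. -/
inductive Coord (n m : ℕ) : Type
  | t : Coord n m
  | x (i : Fin n) : Coord n m
  | u (k : Fin m) (I : Fin n → ℕ) : Coord n m
  deriving DecidableEq

/-- Real functions of all the coordinates. -/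
abbrev Fun (n m : ℕ) : Type := (Coord n m → ℝ) → ℝ

/-- Membership in the algebra of differential functions: smooth functions that depend only on
finitely many of the coordinates. -/
def IsDiffFun {n m : ℕ} (f : Fun n m) : Prop :=
  ∃ (S : Finset (Coord n m)) (g : (S → ℝ) → ℝ),
    ContDiff ℝ ∞ g ∧ ∀ p : Coord n m → ℝ, f p = g (fun z => p z)

/-- The partial derivative with respect to the coordinate `z`. -/
def pd {ι : Type} [DecidableEq ι] (z : ι) (f : (ι → ℝ) → ℝ) : (ι → ℝ) → ℝ :=
  fun p => deriv (fun s => f (Function.update p z s)) (p z)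

/-- The total derivative with respect to `x i`:
`∂/∂x_i + ∑_{k,I} u^k_{I+1_i} ∂/∂u^k_I`. The sum has finitely many nonzero terms on differential
functions. -/
def Dx {n m : ℕ} (i : Fin n) (f : Fun n m) : Fun n m :=
  fun p => pd (.x i) f p +
    ∑ᶠ kI : Fin m × (Fin n → ℕ), p (.u kI.1 (kI.2 + Pi.single i 1)) * pd (.u kI.1 kI.2) f p

/-- The iterated total derivative `D_x^I = D_{x_1}^{I_1} ⋯ D_{x_n}^{I_n}`. -/
def DxI {n m : ℕ} (I : Fin n → ℕ) (f : Fun n m) : Fun n m :=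
  (List.finRange n).foldr (fun i h => (Dx i)^[I i] h) f

/-- The total derivative with respect to `t` on the equation `∂u^k/∂t = F^k`:
`∂/∂t + ∑_{k,I} D_x^I(F^k) ∂/∂u^k_I`. -/
def Dt {n m : ℕ} (F : Fin m → Fun n m) (f : Fun n m) : Fun n m :=
  fun p => pd .t f p +
    ∑ᶠ kI : Fin m × (Fin n → ℕ), DxI kI.2 (F kI.1) p * pd (.u kI.1 kI.2) f p

/-- The total derivatives `D_0 = D_t` and `D_{i+1} = D_{x_i}`. -/
def D {n m : ℕ} (F : Fin m → Fun n m) (k : Fin (n + 1)) : Fun n m → Fun n m :=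
  Fin.cases (Dt F) (fun i => Dx i) k

/-- `J = (J_0, J_1, …, J_n)` is a conserved current: `D_t J_0 + ∑_i D_{x_i} J_i = 0`. -/
def IsConservedCurrent {n m : ℕ} (F : Fin m → Fun n m) (J : Fin (n + 1) → Fun n m) : Prop :=
  (∀ k, IsDiffFun (J k)) ∧ ∀ p, ∑ k, D F k (J k) p = 0

/-- `J` is trivial: `J_k = ∑_{l<k} D_l(L_{lk}) - ∑_{k<l} D_l(L_{kl})` for some differential
functions `L_{kl}`, `k < l`. -/
def IsTrivialCurrent {n m : ℕ} (F : Fin m → Fun n m) (J : Fin (n + 1) → Fun n m) : Prop :=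
  ∃ L : Fin (n + 1) → Fin (n + 1) → Fun n m,
    (∀ k l, k < l → IsDiffFun (L k l)) ∧
    ∀ k p, J k p = ∑ l ∈ Finset.Iio k, D F l (L l k) p - ∑ l ∈ Finset.Ioi k, D F l (L k l) p

/-- Two currents are equivalent if they differ by a trivial one. Conservation laws are the
equivalence classes of conserved currents. -/
def CurrentEquiv {n m : ℕ} (F : Fin m → Fun n m) (J J' : Fin (n + 1) → Fun n m) : Prop :=
  IsTrivialCurrent F (J - J')

/-- The characteristic `χ_k = ∑_I (-1)^{|I|} D_x^I(∂J_0/∂u^k_I)` of a conserved current. -/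
def characteristic {n m : ℕ} (J : Fin (n + 1) → Fun n m) (k : Fin m) : Fun n m :=
  fun p => ∑ᶠ I : Fin n → ℕ, (-1 : ℝ) ^ (∑ i, I i) * DxI I (pd (.u k I) (J 0)) p

/-- The right-hand side of the Brusselator system; `u 0 = v` and `u 1 = w`:
`v_t = Δv + v²w - (b+1)v + a`, `w_t = cΔw - v²w + bv`. -/
def rhs (n : ℕ) (a b c : ℝ) : Fin 2 → Fun n 2 :=
  ![fun p => ∑ i, p (.u 0 (Pi.single i 2)) + p (.u 0 0) ^ 2 * p (.u 1 0)
      - (b + 1) * p (.u 0 0) + a,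
    fun p => c * ∑ i, p (.u 1 (Pi.single i 2)) - p (.u 0 0) ^ 2 * p (.u 1 0)
      + b * p (.u 0 0)]

/-- The space variables of a point. -/
def space {n m : ℕ} (p : Coord n m → ℝ) : Fin n → ℝ := fun i => p (.x i)

/-- `G` is a smooth function of the space variables with `G + (c-1) ΔG = 0`. -/
def IsProfile {n : ℕ} (c : ℝ) (G : (Fin n → ℝ) → ℝ) : Prop :=
  ContDiff ℝ ∞ G ∧ ∀ x, G x + (c - 1) * ∑ i, pd i (pd i G) x = 0

/-- `H i` is a smooth antiderivative `∫ G dx_i` of `G` in the variable `x_i`, for each `i`. -/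
def IsAntiderivatives {n : ℕ} (G : (Fin n → ℝ) → ℝ) (H : Fin n → (Fin n → ℝ) → ℝ) : Prop :=
  ∀ i, ContDiff ℝ ∞ (H i) ∧ ∀ x, pd i (H i) x = G x

/-- The current with components `J_0 = G e^{ct/(c-1)} (v + w)` and
`J_i = e^{ct/(c-1)} (G_{x_i} (v + c w) - G (v_{x_i} + c w_{x_i}) - (a/n) ∫ G dx_i)`. -/
def current {n : ℕ} (a c : ℝ) (G : (Fin n → ℝ) → ℝ) (H : Fin n → (Fin n → ℝ) → ℝ) :
    Fin (n + 1) → Fun n 2 :=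
  Fin.cases
    (fun p => G (space p) * Real.exp (c * p .t / (c - 1)) * (p (.u 0 0) + p (.u 1 0)))
    (fun i p => Real.exp (c * p .t / (c - 1)) *
      (pd i G (space p) * (p (.u 0 0) + c * p (.u 1 0))
        - G (space p) * (p (.u 0 (Pi.single i 1)) + c * p (.u 1 (Pi.single i 1)))
        - a / n * H i (space p)))

end Brusselator

end

open scoped ContDiff

noncomputable section

namespace Brusselator

variable {n m : ℕ}

/-! Work in the algebra of differential functions with the Euler operators E_k = Σ_I (-D)^I
∂/∂u^k_I, so that the characteristic of J is χ_k = E_k(J_0). Two facts carry the theorem.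

Characteristics. E_k kills every D_i f (`euler_X`), and its commutator with D_t is the adjoint
linearization of the system (`euler_T`). Applying E_k to the conservation law therefore gives, for p
= χ_1 and q = χ_2, D_t p + Δp + (2vw - b - 1)p + (b - 2vw)q = 0 and D_t q + cΔq + v²(p - q) = 0. If
p and q have order at most r in the u^k_I, differentiating twice beyond that order multiplies the
leading symbol by (d_k + κ)|ξ|², where d = (1, c) and κ is 1 for p and c for q. These factors are 2,
1 + c and 2c, so the order drops unless c = -1. In that case the next two orders force the leading
coefficients to depend on t, x alone, and the mixed derivative ∂_v∂_w of the order r terms kills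
them (`Pd_Pd_top_eq_zero`, `ordLt_succ_step`). Hence p, q depend on t, x only, the coefficient of vw
gives p = q, and what remains is p_t + Δp = p, p_t + cΔp = 0, that is p + (c - 1)Δp = 0 and (c -
1)p_t = cp. For c = 1 this says p = 0; otherwise p = G e^{ct/(c-1)}.

Triviality. A conserved current with E_k(J_0) = 0 is trivial (`exists_potential`). By the homotopy
formula f - f|_{u=0} = Σ u^k_I ∫_0^1 (∂f/∂u^k_I)(t, x, ru) dr and integration by parts, J_0 is a
divergence. Removing it leaves a divergence-free spatial current, and the same argument, with
integration by parts in only some of the directions, gives its potentials by induction on the number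
of directions.

For c ≠ 1 the explicit current has the same characteristic as J, so their difference is trivial by
the second fact. -/

/-! ### Smooth dependence of integrals on parameters -/

open intervalIntegral MeasureTheory in
theorem hasFDerivAt_integral_of_contDiff {E F : Type} [NormedAddCommGroup E] [NormedSpace ℝ E]
    [FiniteDimensional ℝ E] [NormedAddCommGroup F] [NormedSpace ℝ F] [CompleteSpace F]
    {f : E × ℝ → F} (hf : ContDiff ℝ ∞ f) (x : E) :
    HasFDerivAt (fun x => ∫ s in (0:ℝ)..1, f (x, s))
      (∫ s in (0:ℝ)..1, (fderiv ℝ f (x, s)).comp (ContinuousLinearMap.inl ℝ E ℝ)) x := by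
  have hd : Differentiable ℝ f := hf.differentiable (by simp)
  have hc : Continuous f := hf.continuous
  have hF' : Continuous (fun y : E × ℝ =>
      (fderiv ℝ f y).comp (ContinuousLinearMap.inl ℝ E ℝ)) :=
    (hf.continuous_fderiv (by simp)).clm_comp
      (continuous_const (y := ContinuousLinearMap.inl ℝ E ℝ))
  -- Finite dimension makes the closed ball compact, so a constant dominates the derivative.
  obtain ⟨C, hC⟩ := ((isCompact_closedBall x (1:ℝ)).prod
    (isCompact_Icc (a := (0:ℝ)) (b := 1))).exists_bound_of_continuousOn hF'.continuousOn
  refine intervalIntegral.hasFDerivAt_integral_of_dominated_of_fderiv_le (𝕜 := ℝ)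
    (F := fun x s => f (x, s))
    (F' := fun x s => (fderiv ℝ f (x, s)).comp (ContinuousLinearMap.inl ℝ E ℝ))
    (bound := fun _ => C) (Metric.closedBall_mem_nhds x one_pos)
    (Filter.Eventually.of_forall fun y => ?_) ?_ ?_ ?_ ?_ ?_
  · exact (hc.comp (by fun_prop : Continuous fun s : ℝ => (y, s))).aestronglyMeasurable
  · exact (hc.comp (by fun_prop : Continuous fun s : ℝ => (x, s))).intervalIntegrable _ _
  · exact (hF'.comp (by fun_prop : Continuous fun s : ℝ => (x, s))).aestronglyMeasurable
  · refine Filter.Eventually.of_forall fun s hs y hy => hC (y, s) ⟨hy, ?_⟩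
    rw [Set.uIoc_of_le zero_le_one] at hs
    exact ⟨hs.1.le, hs.2⟩
  · exact intervalIntegrable_const
  · refine Filter.Eventually.of_forall fun s _ y _ => ?_
    exact (hd (y, s)).hasFDerivAt.comp y (hasFDerivAt_prodMk_left y s)

/-- The derivative is an integral of the same kind with values in the continuous linear maps, so the
induction on the order of differentiability must let `F` vary. -/
theorem contDiff_integral_of_contDiff {E F : Type} [NormedAddCommGroup E] [NormedSpace ℝ E]
    [FiniteDimensional ℝ E] [NormedAddCommGroup F] [NormedSpace ℝ F] [CompleteSpace F]
    {f : E × ℝ → F} (hf : ContDiff ℝ ∞ f) :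
    ContDiff ℝ ∞ (fun x => ∫ s in (0:ℝ)..1, f (x, s)) := by
  rw [contDiff_infty]
  intro N
  induction N generalizing F with
  | zero =>
    exact contDiff_zero.2 (continuous_iff_continuousAt.2 fun x =>
      (hasFDerivAt_integral_of_contDiff hf x).continuousAt)
  | succ N ih =>
    push_cast
    rw [contDiff_succ_iff_fderiv]
    refine ⟨fun x => (hasFDerivAt_integral_of_contDiff hf x).differentiableAt, by simp, ?_⟩
    have := ih (f := fun y : E × ℝ => (fderiv ℝ f y).comp (ContinuousLinearMap.inl ℝ E ℝ))
      ((hf.fderiv_right (m := ∞) (by simp)).clm_comp contDiff_const)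
    convert this using 2 with x
    exact (hasFDerivAt_integral_of_contDiff hf x).fderiv

/-! ### The algebra of differential functions and its partial derivatives -/

/-- The restriction of a point to finitely many coordinates. -/
def restr {ι : Type} (S : Finset ι) (p : ι → ℝ) : S → ℝ := fun z => p z

theorem IsDiffFun.exists_superset {f : Fun n m} (hf : IsDiffFun f) (T : Finset (Coord n m)) :
    ∃ S, T ⊆ S ∧ ∃ g : (S → ℝ) → ℝ, ContDiff ℝ ∞ g ∧ ∀ p, f p = g (restr S p) := by
  classical
  obtain ⟨S, g, hg, hfg⟩ := hf
  refine ⟨T ∪ S, Finset.subset_union_left,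
    fun q => g (fun z => q ⟨z, Finset.subset_union_right z.2⟩), hg.comp ?_, fun p => hfg p⟩
  fun_prop

theorem isDiffFun_pair {f g : Fun n m} (hf : IsDiffFun f) (hg : IsDiffFun g) :
    ∃ (S : Finset (Coord n m)) (f' g' : (S → ℝ) → ℝ), ContDiff ℝ ∞ f' ∧ ContDiff ℝ ∞ g' ∧
      (∀ p, f p = f' (restr S p)) ∧ ∀ p, g p = g' (restr S p) := by
  obtain ⟨T, f', hf', h1⟩ := hf
  obtain ⟨S, hTS, g', hg', h2⟩ := hg.exists_superset T
  exact ⟨S, fun q => f' (fun z => q ⟨z, hTS z.2⟩), g', hf'.comp (by fun_prop), hg', h1, h2⟩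

variable (n m) in
/-- The algebra of differential functions. -/
def diffFunAlg : Subalgebra ℝ (Fun n m) where
  carrier := {f | IsDiffFun f}
  mul_mem' := fun hf hg => by
    obtain ⟨S, f', g', hf', hg', h1, h2⟩ := isDiffFun_pair hf hg
    exact ⟨S, f' * g', hf'.mul hg', fun p => congrArg₂ _ (h1 p) (h2 p)⟩
  add_mem' := fun hf hg => by
    obtain ⟨S, f', g', hf', hg', h1, h2⟩ := isDiffFun_pair hf hg
    exact ⟨S, f' + g', hf'.add hg', fun p => congrArg₂ _ (h1 p) (h2 p)⟩
  algebraMap_mem' := fun r => ⟨∅, fun _ => r, contDiff_const, fun _ => rfl⟩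

variable (n m) in
/-- Differential functions as a type. -/
def DiffFun : Type := diffFunAlg n m

namespace DiffFun

instance : CommRing (DiffFun n m) := inferInstanceAs (CommRing (diffFunAlg n m))

instance : Algebra ℝ (DiffFun n m) := inferInstanceAs (Algebra ℝ (diffFunAlg n m))

instance : CoeOut (DiffFun n m) (Fun n m) := ⟨fun f => f.1⟩

theorem isDiffFun (f : DiffFun n m) : IsDiffFun (f : Fun n m) := f.2

theorem ext {f g : DiffFun n m} (h : ∀ p, (f : Fun n m) p = (g : Fun n m) p) : f = g :=
  Subtype.ext (funext h)

@[simp] theorem add_apply (f g : DiffFun n m) (p : Coord n m → ℝ) :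
    ((f + g : DiffFun n m) : Fun n m) p = (f : Fun n m) p + (g : Fun n m) p := rfl

@[simp] theorem sub_apply (f g : DiffFun n m) (p : Coord n m → ℝ) :
    ((f - g : DiffFun n m) : Fun n m) p = (f : Fun n m) p - (g : Fun n m) p := rfl

@[simp] theorem neg_apply (f : DiffFun n m) (p : Coord n m → ℝ) :
    ((-f : DiffFun n m) : Fun n m) p = -(f : Fun n m) p := rfl

@[simp] theorem mul_apply (f g : DiffFun n m) (p : Coord n m → ℝ) :
    ((f * g : DiffFun n m) : Fun n m) p = (f : Fun n m) p * (g : Fun n m) p := rfl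

@[simp] theorem smul_apply (r : ℝ) (f : DiffFun n m) (p : Coord n m → ℝ) :
    ((r • f : DiffFun n m) : Fun n m) p = r * (f : Fun n m) p := rfl

@[simp] theorem zero_apply (p : Coord n m → ℝ) : ((0 : DiffFun n m) : Fun n m) p = 0 := rfl

@[simp] theorem one_apply (p : Coord n m → ℝ) : ((1 : DiffFun n m) : Fun n m) p = 1 := rfl

@[simp] theorem pow_apply (f : DiffFun n m) (N : ℕ) (p : Coord n m → ℝ) :
    ((f ^ N : DiffFun n m) : Fun n m) p = (f : Fun n m) p ^ N := rfl

@[simp] theorem algebraMap_apply (r : ℝ) (p : Coord n m → ℝ) :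
    ((algebraMap ℝ (DiffFun n m) r : DiffFun n m) : Fun n m) p = r := rfl

@[simp] theorem sum_apply {α : Type} (s : Finset α) (f : α → DiffFun n m) (p : Coord n m → ℝ) :
    ((∑ a ∈ s, f a : DiffFun n m) : Fun n m) p = ∑ a ∈ s, (f a : Fun n m) p := by
  classical
  induction s using Finset.induction_on with
  | empty => simp
  | insert a s ha ih => simp [Finset.sum_insert ha, ih]

end DiffFun

/-- The coordinate `z` as a differential function. -/
def coord (z : Coord n m) : DiffFun n m :=
  ⟨fun p => p z, {z}, fun q => q ⟨z, by simp⟩, by fun_prop, fun _ => rfl⟩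

@[simp] theorem coord_apply (z : Coord n m) (p : Coord n m → ℝ) : (coord z : Fun n m) p = p z := rfl

theorem hasDerivAt_restr_update {ι : Type} [DecidableEq ι] (S : Finset ι) (p : ι → ℝ) (z : ι)
    (s : ℝ) : HasDerivAt (fun s => restr S (Function.update p z s)) (restr S (Pi.single z 1)) s := by
  rw [hasDerivAt_pi]
  rintro ⟨y, hy⟩
  by_cases h : y = z
  · subst h; simpa [restr] using hasDerivAt_id' s
  · simpa [restr, h] using hasDerivAt_const s (p y)

theorem hasDerivAt_update_of_contDiff {ι : Type} [DecidableEq ι] {f : (ι → ℝ) → ℝ} {S : Finset ι}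
    {g : (S → ℝ) → ℝ} (hg : ContDiff ℝ ∞ g) (hf : ∀ p, f p = g (restr S p)) (z : ι) (p : ι → ℝ)
    (s : ℝ) : HasDerivAt (fun s => f (Function.update p z s))
      (fderiv ℝ g (restr S (Function.update p z s)) (restr S (Pi.single z 1))) s := by
  simp only [hf]
  exact ((hg.differentiable (by simp)) _).hasFDerivAt.comp_hasDerivAt s
    (hasDerivAt_restr_update S p z s)

theorem pd_eq_fderiv {ι : Type} [DecidableEq ι] {f : (ι → ℝ) → ℝ} {S : Finset ι} {g : (S → ℝ) → ℝ}
    (hg : ContDiff ℝ ∞ g) (hf : ∀ p, f p = g (restr S p)) (z : ι) (p : ι → ℝ) :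
    pd z f p = fderiv ℝ g (restr S p) (restr S (Pi.single z 1)) := by
  have := (hasDerivAt_update_of_contDiff hg hf z p (p z)).deriv
  rwa [Function.update_eq_self] at this

theorem fderiv_restr_eq_sum {ι : Type} [DecidableEq ι] {f : (ι → ℝ) → ℝ} {S : Finset ι}
    {g : (S → ℝ) → ℝ} (hg : ContDiff ℝ ∞ g) (hf : ∀ p, f p = g (restr S p)) (p v : ι → ℝ) :
    fderiv ℝ g (restr S p) (restr S v) = ∑ z ∈ S, v z * pd z f p := by
  rw [← Finset.sum_coe_sort S (fun z => v z * pd z f p)]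
  have : restr S v = ∑ z : S, v z • restr S (Pi.single (z : ι) 1) := by
    ext y
    simp only [restr, Finset.sum_apply, Pi.smul_apply, smul_eq_mul, Pi.single_apply, mul_ite,
      mul_one, mul_zero]
    rw [Finset.sum_eq_single y (fun b _ hb => if_neg fun e => hb (Subtype.ext e.symm))
      (fun h => absurd (Finset.mem_univ y) h), if_pos rfl]
  rw [this, map_sum]
  simp [pd_eq_fderiv hg hf]

theorem isDiffFun_pd {f : Fun n m} (hf : IsDiffFun f) (z : Coord n m) : IsDiffFun (pd z f) := by
  obtain ⟨S, g, hg, h⟩ := hf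
  exact ⟨S, fun q => fderiv ℝ g q (restr S (Pi.single z 1)),
    (hg.fderiv_right (m := ∞) (by simp)).clm_apply contDiff_const, fun p => pd_eq_fderiv hg h z p⟩

theorem hasDerivAt_update {f : Fun n m} (hf : IsDiffFun f) (z : Coord n m) (p : Coord n m → ℝ)
    (s : ℝ) : HasDerivAt (fun s => f (Function.update p z s))
      (pd z f (Function.update p z s)) s := by
  obtain ⟨S, g, hg, h⟩ := hf
  have := hasDerivAt_update_of_contDiff hg h z p s
  rwa [← pd_eq_fderiv hg h] at this

theorem hasDerivAt_update_self {f : Fun n m} (hf : IsDiffFun f) (z : Coord n m) (p : Coord n m → ℝ) :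
    HasDerivAt (fun s => f (Function.update p z s)) (pd z f p) (p z) := by
  have := hasDerivAt_update hf z p (p z)
  rwa [Function.update_eq_self] at this

/-- The partial derivatives as derivations of the algebra of differential functions. -/
def Pd (z : Coord n m) : Derivation ℝ (DiffFun n m) (DiffFun n m) :=
  Derivation.mk'
    { toFun := fun f => ⟨pd z f, isDiffFun_pd f.2 z⟩
      map_add' := fun f g => DiffFun.ext fun p =>
        ((hasDerivAt_update_self f.2 z p).add (hasDerivAt_update_self g.2 z p)).deriv
      map_smul' := fun r f => DiffFun.ext fun p =>
        ((hasDerivAt_update_self f.2 z p).const_mul r).deriv }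
    fun f g => DiffFun.ext fun p => by
      have := ((hasDerivAt_update_self f.2 z p).mul (hasDerivAt_update_self g.2 z p)).deriv
      simp only [Function.update_eq_self] at this
      refine this.trans ?_
      change _ = (f : Fun n m) p * pd z g p + (g : Fun n m) p * pd z f p
      ring

theorem coe_Pd (z : Coord n m) (f : DiffFun n m) : (Pd z f : Fun n m) = pd z f := rfl

theorem Pd_comm (y z : Coord n m) (f : DiffFun n m) : Pd y (Pd z f) = Pd z (Pd y f) := by
  obtain ⟨S, g, hg, h⟩ := f.2
  have hg' : Differentiable ℝ (fderiv ℝ g) :=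
    (hg.fderiv_right (m := ∞) (by simp)).differentiable (by simp)
  have key : ∀ (y z : Coord n m) (p : Coord n m → ℝ), pd y (pd z f) p =
      fderiv ℝ (fderiv ℝ g) (restr S p) (restr S (Pi.single y 1)) (restr S (Pi.single z 1)) := by
    intro y z p
    rw [pd_eq_fderiv (g := fun q => fderiv ℝ g q (restr S (Pi.single z 1)))
      ((hg.fderiv_right (m := ∞) (by simp)).clm_apply contDiff_const)
      (fun p => pd_eq_fderiv hg h z p)]
    rw [fderiv_clm_apply (hg' _) (by fun_prop)]
    simp
  refine DiffFun.ext fun p => ?_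
  rw [coe_Pd, coe_Pd, coe_Pd, coe_Pd, key, key]
  have : IsSymmSndFDerivAt ℝ g (restr S p) :=
    hg.contDiffAt.isSymmSndFDerivAt (by
      rw [minSmoothness_of_isRCLikeNormedField]; exact WithTop.coe_le_coe.2 le_top)
  exact this _ _

theorem Pd_coord (y z : Coord n m) : Pd y (coord z) = if y = z then 1 else 0 := by
  refine DiffFun.ext fun p => ?_
  by_cases h : y = z
  · subst h
    simp [coe_Pd, pd]
  · simp [coe_Pd, pd, h, Function.update_of_ne (Ne.symm h)]

theorem Pd_eq_zero_of_notMem {f : DiffFun n m} {S : Finset (Coord n m)} {g : (S → ℝ) → ℝ}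
    (hg : ContDiff ℝ ∞ g) (h : ∀ p, (f : Fun n m) p = g (restr S p)) {z : Coord n m} (hz : z ∉ S) :
    Pd z f = 0 := by
  refine DiffFun.ext fun p => ?_
  rw [coe_Pd, pd_eq_fderiv hg h]
  have : restr S (Pi.single z (1:ℝ)) = 0 := by
    ext y
    have : (y : Coord n m) ≠ z := fun e => hz (e ▸ y.2)
    simp [restr, this]
  simp [this]

theorem finite_support_Pd (f : DiffFun n m) : {z | Pd z f ≠ 0}.Finite := by
  obtain ⟨S, g, hg, h⟩ := f.2
  refine S.finite_toSet.subset fun z hz => ?_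
  by_contra hzS
  exact hz (Pd_eq_zero_of_notMem hg h hzS)

/-! ### Averages over rescalings, the homotopy formula and antiderivatives -/

/-- Multiplication by `r` of the coordinates selected by `Z`. -/
def scale {ι : Type} (Z : ι → Bool) (r : ℝ) (p : ι → ℝ) : ι → ℝ :=
  fun z => if Z z then r * p z else p z

@[simp] theorem scale_one {ι : Type} (Z : ι → Bool) (p : ι → ℝ) : scale Z 1 p = p := by
  funext z; simp [scale]

theorem contDiff_scale {ι : Type} [Fintype ι] (Z : ι → Bool) :
    ContDiff ℝ ∞ (fun y : (ι → ℝ) × ℝ => scale Z y.2 y.1) := by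
  rw [contDiff_pi]
  intro z
  unfold scale
  split_ifs <;> fun_prop

theorem hasFDerivAt_scale {ι : Type} [Fintype ι] (Z : ι → Bool) (r : ℝ) (q : ι → ℝ) :
    HasFDerivAt (scale Z r) (ContinuousLinearMap.pi fun z =>
      (if Z z then r else 1) • ContinuousLinearMap.proj (R := ℝ) (φ := fun _ : ι => ℝ) z) q := by
  have : scale Z r = ⇑(ContinuousLinearMap.pi fun z =>
      (if Z z then r else 1) • ContinuousLinearMap.proj (R := ℝ) (φ := fun _ : ι => ℝ) z) := by
    funext q z
    by_cases h : Z z <;> simp [scale, h]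
  rw [this]
  exact ContinuousLinearMap.hasFDerivAt _

theorem restr_scale {ι : Type} (S : Finset ι) (Z : ι → Bool) (r : ℝ) (p : ι → ℝ) :
    restr S (scale Z r p) = scale (fun z : S => Z z) r (restr S p) := rfl

theorem continuous_scale (f : DiffFun n m) (Z : Coord n m → Bool) (p : Coord n m → ℝ) :
    Continuous fun r => (f : Fun n m) (scale Z r p) := by
  obtain ⟨S, g, hg, h⟩ := f.2
  have h' : ∀ p, (f : Fun n m) p = g (restr S p) := h
  simp only [h', restr_scale]
  exact hg.continuous.comp ((contDiff_scale _).continuous.comp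
    (by fun_prop : Continuous fun r : ℝ => (restr S p, r)))

/-- The average of `f` over the rescalings of the coordinates selected by `Z`. -/
def Avg (Z : Coord n m → Bool) : DiffFun n m →ₗ[ℝ] DiffFun n m where
  toFun f := ⟨fun p => ∫ r in (0:ℝ)..1, (f : Fun n m) (scale Z r p), by
    obtain ⟨S, g, hg, h⟩ := f.2
    have h' : ∀ p, (f : Fun n m) p = g (restr S p) := h
    simp only [h', restr_scale]
    exact ⟨S, fun q => ∫ r in (0:ℝ)..1, g (scale (fun z : S => Z z) r q),
      contDiff_integral_of_contDiff (f := fun y : (S → ℝ) × ℝ => g (scale (fun z : S => Z z) y.2 y.1))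
        (hg.comp (contDiff_scale _)), fun p => rfl⟩⟩
  map_add' f g := DiffFun.ext fun p =>
    intervalIntegral.integral_add ((continuous_scale f Z p).intervalIntegrable _ _)
      ((continuous_scale g Z p).intervalIntegrable _ _)
  map_smul' c f := DiffFun.ext fun p => intervalIntegral.integral_const_mul c _

theorem Avg_apply (Z : Coord n m → Bool) (f : DiffFun n m) (p : Coord n m → ℝ) :
    (Avg Z f : Fun n m) p = ∫ r in (0:ℝ)..1, (f : Fun n m) (scale Z r p) := rfl

theorem Pd_Avg_apply (Z : Coord n m → Bool) (f : DiffFun n m) (z : Coord n m)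
    (p : Coord n m → ℝ) : (Pd z (Avg Z f) : Fun n m) p =
      ∫ r in (0:ℝ)..1, (if Z z then r else 1) * (Pd z f : Fun n m) (scale Z r p) := by
  obtain ⟨S, g, hg, h⟩ := f.2
  have h' : ∀ p, (f : Fun n m) p = g (restr S p) := h
  set ZS : S → Bool := fun z => Z z
  set F : (S → ℝ) × ℝ → ℝ := fun y => g (scale ZS y.2 y.1)
  have hF : ContDiff ℝ ∞ F := hg.comp (contDiff_scale _)
  have hA : ∀ p, (Avg Z f : Fun n m) p = (fun q => ∫ r in (0:ℝ)..1, F (q, r)) (restr S p) := by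
    intro p
    simp only [Avg_apply, h', restr_scale]; rfl
  rw [coe_Pd, pd_eq_fderiv (contDiff_integral_of_contDiff hF) hA,
    (hasFDerivAt_integral_of_contDiff hF _).fderiv]
  rw [ContinuousLinearMap.intervalIntegral_apply]
  · congr 1
    funext r
    have h1 : HasFDerivAt (fun q => F (q, r)) ((fderiv ℝ F (restr S p, r)).comp
        (ContinuousLinearMap.inl ℝ (S → ℝ) ℝ)) (restr S p) :=
      (hF.differentiable (by simp) _).hasFDerivAt.comp _ (hasFDerivAt_prodMk_left _ _)
    have h2 : HasFDerivAt (fun q => F (q, r)) _ (restr S p) :=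
      (hg.differentiable (by simp) _).hasFDerivAt.comp _ (hasFDerivAt_scale ZS r (restr S p))
    rw [h1.unique h2, coe_Pd, pd_eq_fderiv hg h', restr_scale]
    rw [ContinuousLinearMap.comp_apply, ← smul_eq_mul, ← map_smul]
    congr 1
    ext y
    change (if Z y then r else 1) * (Pi.single z (1:ℝ) : Coord n m → ℝ) y =
      (if Z z then r else 1) * (Pi.single z (1:ℝ) : Coord n m → ℝ) y
    by_cases hy : (y : Coord n m) = z
    · rw [hy]
    · simp [hy]
  · refine Continuous.intervalIntegrable ?_ _ _
    exact ((hF.continuous_fderiv (by simp)).comp (by fun_prop : Continuous fun s : ℝ =>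
      (restr S p, s))).clm_comp continuous_const

theorem Pd_Avg_of_not (Z : Coord n m → Bool) (f : DiffFun n m) {z : Coord n m} (hz : Z z = false) :
    Pd z (Avg Z f) = Avg Z (Pd z f) :=
  DiffFun.ext fun p => by rw [Pd_Avg_apply, Avg_apply]; simp [hz]

/-- The field y ∂/∂z is homogeneous of degree zero in the selected coordinates, hence commutes with
their rescaling: the factor r from the chain rule turns p_y into (rp)_y. -/
theorem coord_mul_Pd_Avg (Z : Coord n m → Bool) (f : DiffFun n m) {y z : Coord n m}
    (hy : Z y = true) (hz : Z z = true) :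
    coord y * Pd z (Avg Z f) = Avg Z (coord y * Pd z f) :=
  DiffFun.ext fun p => by
    change p y * (Pd z (Avg Z f) : Fun n m) p = _
    rw [Pd_Avg_apply, Avg_apply, ← intervalIntegral.integral_const_mul]
    congr 1
    funext r
    change _ = (scale Z r p) y * (Pd z f : Fun n m) (scale Z r p)
    simp [hz, hy, scale]
    ring

theorem hasDerivAt_scale (Z : Coord n m → Bool) (f : DiffFun n m) (S : Finset (Coord n m))
    (hS : ∀ z, Z z = true → z ∉ S → Pd z f = 0) (p : Coord n m → ℝ) (r : ℝ) :
    HasDerivAt (fun r => (f : Fun n m) (scale Z r p))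
      (∑ z ∈ S with Z z, p z * (Pd z f : Fun n m) (scale Z r p)) r := by
  obtain ⟨T, hST, g, hg, h⟩ := f.isDiffFun.exists_superset S
  set v : Coord n m → ℝ := fun z => if Z z then p z else 0
  have h1 : HasDerivAt (fun r => restr T (scale Z r p)) (restr T v) r := by
    rw [hasDerivAt_pi]
    intro z
    by_cases hz : Z z
    · simpa [restr, scale, v, hz] using (hasDerivAt_id' r).mul_const (p z)
    · simpa [restr, scale, v, hz] using hasDerivAt_const r (p z)
  have h2 := ((hg.differentiable (by simp)) _).hasFDerivAt.comp_hasDerivAt r h1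
  rw [fderiv_restr_eq_sum hg h] at h2
  simp only [h]
  refine h2.congr_deriv ?_
  rw [Finset.sum_filter]
  symm
  simp only [v, ite_mul, zero_mul]
  refine Finset.sum_subset hST fun z _ hz => ?_
  by_cases hZ : Z z
  · simp [hS z hZ hz]
  · simp [hZ]

/-- The restriction of `f` to the points where the coordinates selected by `Z` vanish. -/
def atZero (Z : Coord n m → Bool) (f : DiffFun n m) : DiffFun n m :=
  ⟨fun p => (f : Fun n m) (scale Z 0 p), by
    obtain ⟨S, g, hg, h⟩ := f.2
    exact ⟨S, fun q => g (scale (fun z : S => Z z) 0 q),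
      hg.comp ((contDiff_scale _).comp (contDiff_prodMk_left (0:ℝ))), fun p => h _⟩⟩

theorem Pd_atZero (Z : Coord n m → Bool) (f : DiffFun n m) {z : Coord n m} (hz : Z z = true) :
    Pd z (atZero Z f) = 0 := by
  refine DiffFun.ext fun p => ?_
  have : ∀ s, scale Z 0 (Function.update p z s) = scale Z 0 p := by
    intro s
    funext y
    by_cases hy : y = z
    · subst hy; simp [scale, hz]
    · simp [scale, hy]
  rw [coe_Pd]
  simp [pd, atZero, this]

/-- The fundamental theorem of calculus along r ↦ `scale Z r p` from 0 to 1. -/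
theorem sub_atZero (Z : Coord n m → Bool) (f : DiffFun n m) (S : Finset (Coord n m))
    (hS : ∀ z, Z z = true → z ∉ S → Pd z f = 0) :
    f - atZero Z f = ∑ z ∈ S with Z z, coord z * Avg Z (Pd z f) := by
  refine DiffFun.ext fun p => ?_
  have hc : ∀ z, Continuous fun r => p z * (Pd z f : Fun n m) (scale Z r p) := fun z =>
    continuous_const.mul (continuous_scale (Pd z f) Z p)
  have h1 := intervalIntegral.integral_eq_sub_of_hasDerivAt (a := 0) (b := 1)
    (fun r _ => hasDerivAt_scale Z f S hS p r)
    ((continuous_finsetSum _ fun z _ => hc z).intervalIntegrable _ _)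
  rw [scale_one, intervalIntegral.integral_finsetSum
    fun z _ => (hc z).intervalIntegrable _ _] at h1
  simp only [intervalIntegral.integral_const_mul] at h1
  refine h1.symm.trans ?_
  rw [DiffFun.sum_apply]
  rfl

/-- The averaged function along the scaling is d/dr of r f, so its integral over [0, 1] is f. This
is what makes `antideriv` an antiderivative. -/
theorem Avg_add_coord_mul_Pd (z : Coord n m) (f : DiffFun n m) :
    Avg (fun y => decide (y = z)) (f + coord z * Pd z f) = f := by
  refine DiffFun.ext fun p => ?_
  set Z : Coord n m → Bool := fun y => decide (y = z)
  have h0 : ∀ r, HasDerivAt (fun r => r * (f : Fun n m) (scale Z r p))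
      (((f + coord z * Pd z f : DiffFun n m) : Fun n m) (scale Z r p)) r := by
    intro r
    have := (hasDerivAt_id' r).mul (hasDerivAt_scale Z f {z}
      (fun y hy hy' => absurd (by simpa [Z] using hy) (by simpa using hy')) p r)
    rw [Finset.filter_singleton, if_pos (by simp [Z]), Finset.sum_singleton] at this
    refine this.congr_deriv ?_
    change _ = (f : Fun n m) (scale Z r p) + scale Z r p z * (Pd z f : Fun n m) (scale Z r p)
    simp [scale, Z]
    ring
  have h1 := intervalIntegral.integral_eq_sub_of_hasDerivAt (a := 0) (b := 1) (fun r _ => h0 r)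
    ((continuous_scale _ Z p).intervalIntegrable _ _)
  rw [Avg_apply, h1]
  simp

/-- The antiderivative of `f` in the coordinate `z` that vanishes at `z = 0`. -/
def antideriv (z : Coord n m) (f : DiffFun n m) : DiffFun n m :=
  coord z * Avg (fun y => decide (y = z)) f

theorem Pd_antideriv_self (z : Coord n m) (f : DiffFun n m) : Pd z (antideriv z f) = f := by
  conv_rhs => rw [← Avg_add_coord_mul_Pd z f]
  rw [antideriv, Derivation.leibniz, Pd_coord, if_pos rfl, smul_eq_mul, smul_eq_mul, mul_one,
    coord_mul_Pd_Avg _ _ (by simp) (by simp), map_add, add_comm]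

theorem Pd_antideriv_of_ne {y z : Coord n m} (h : y ≠ z) (f : DiffFun n m) :
    Pd y (antideriv z f) = antideriv z (Pd y f) := by
  rw [antideriv, Derivation.leibniz, Pd_coord, if_neg h, smul_eq_mul, smul_eq_mul, mul_zero,
    add_zero, Pd_Avg_of_not _ _ (by simpa using h), antideriv]

theorem antideriv_zero (z : Coord n m) : antideriv z (0 : DiffFun n m) = 0 := by simp [antideriv]

/-! ### Multi-indices and monomials in commuting operators -/

theorem multiIndex_induction {P : (Fin n → ℕ) → Prop} (h0 : P 0)
    (hs : ∀ K i, P K → P (K + Pi.single i 1)) (K : Fin n → ℕ) : P K := by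
  induction h : ∑ i, K i generalizing K with
  | zero =>
    have : K = 0 := by
      funext i
      exact (Finset.sum_eq_zero_iff.1 h) i (Finset.mem_univ i)
    exact this ▸ h0
  | succ N ih =>
    obtain ⟨i, hi⟩ : ∃ i, K i ≠ 0 := by
      by_contra! hK
      simp [hK] at h
    have hK : K = (K - Pi.single i 1) + Pi.single i 1 := by
      funext j
      by_cases hj : j = i
      · subst hj; simp; omega
      · simp [hj]
    rw [hK]
    refine hs _ _ (ih _ ?_)
    have h2 : ∑ j, K j = ∑ j, (K - Pi.single i 1 : Fin n → ℕ) j + 1 := by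
      conv_lhs => rw [hK]
      simp [Finset.sum_add_distrib]
    omega

section Monomials

variable {M M' : Type} [AddCommGroup M] [Module ℝ M] [AddCommGroup M'] [Module ℝ M']

/-- The monomial `T_1^{K_1} ⋯ T_n^{K_n}` of a family of endomorphisms. -/
def mon (T : Fin n → Module.End ℝ M) (K : Fin n → ℕ) : Module.End ℝ M :=
  ((List.finRange n).map fun i => T i ^ K i).prod

@[simp] theorem mon_zero (T : Fin n → Module.End ℝ M) : mon T 0 = 1 := by
  simp [mon]

/-- The product runs over the directions in a fixed order; commutativity is needed to bring the new
factor to the front. -/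
theorem mon_add_single {T : Fin n → Module.End ℝ M} (hT : ∀ i j, Commute (T i) (T j))
    (K : Fin n → ℕ) (i : Fin n) : mon T (K + Pi.single i 1) = T i * mon T K := by
  have key : ∀ l : List (Fin n), l.Nodup →
      (l.map fun j => T j ^ (K + Pi.single i 1 : Fin n → ℕ) j).prod =
        (if i ∈ l then T i else 1) * (l.map fun j => T j ^ K j).prod := by
    intro l
    induction l with
    | nil => simp
    | cons j l ih =>
      intro hl
      rw [List.nodup_cons] at hl
      rw [List.map_cons, List.prod_cons, ih hl.2, List.map_cons, List.prod_cons]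
      by_cases hj : j = i
      · subst hj
        simp [hl.1, pow_succ', mul_assoc]
      · have hc : Commute (T j ^ K j) (if i ∈ l then T i else 1) := by
          split_ifs
          · exact (hT j i).pow_left _
          · exact Commute.one_right _
        simp only [Pi.add_apply, Pi.single_eq_of_ne hj, add_zero, List.mem_cons, Ne.symm hj,
          false_or]
        rw [← mul_assoc, hc.eq, mul_assoc]
  simpa [mon] using key _ (List.nodup_finRange n)

theorem mon_intertwine {T : Fin n → Module.End ℝ M} {T' : Fin n → Module.End ℝ M'}
    (φ : M →ₗ[ℝ] M') (h : ∀ i x, φ (T i x) = T' i (φ x)) (K : Fin n → ℕ) (x : M) :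
    φ (mon T K x) = mon T' K (φ x) := by
  have key : ∀ l : List (Fin n), φ ((l.map fun i => T i ^ K i).prod x) =
      (l.map fun i => T' i ^ K i).prod (φ x) := by
    intro l
    induction l with
    | nil => rfl
    | cons j l ih =>
      have hp : ∀ (N : ℕ) (y : M), φ ((T j ^ N) y) = (T' j ^ N) (φ y) := by
        intro N y
        induction N with
        | zero => rfl
        | succ N ihN =>
          rw [pow_succ', pow_succ', Module.End.mul_apply, Module.End.mul_apply, h, ihN]
      simp only [List.map_cons, List.prod_cons, Module.End.mul_apply, hp, ih]
  exact key _

end Monomials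

/-! ### Families of derivatives and the fields Σ a^k_I ∂/∂u^k_I -/

variable (n m) in
/-- Finitely supported families of differential functions indexed by multi-indices. -/
abbrev Jet : Type := (Fin n → ℕ) →₀ DiffFun n m

/-- All the derivatives `∂/∂u^k_I` at once. -/
def dU (k : Fin m) : Derivation ℝ (DiffFun n m) (Jet n m) :=
  have hfin : ∀ f : DiffFun n m, (Function.support fun I => Pd (.u k I) f).Finite := fun f =>
    (finite_support_Pd f).preimage fun I _ J _ h => by cases h; rfl
  Derivation.mk'
    { toFun := fun f => Finsupp.ofSupportFinite (fun I => Pd (.u k I) f) (hfin f)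
      map_add' := fun f g => Finsupp.ext fun I => (Pd (.u k I)).map_add f g
      map_smul' := fun r f => Finsupp.ext fun I => (Pd (.u k I)).map_smul r f }
    fun f g => Finsupp.ext fun I => (Pd (.u k I)).leibniz f g

@[simp] theorem dU_apply (k : Fin m) (f : DiffFun n m) (I : Fin n → ℕ) :
    dU k f I = Pd (.u k I) f := rfl

/-- The shift of a family by the multi-index `1_i`. -/
def shift (i : Fin n) : Jet n m →ₗ[DiffFun n m] Jet n m :=
  Finsupp.lmapDomain (DiffFun n m) (DiffFun n m) (· + Pi.single i 1)

@[simp] theorem shift_single (i : Fin n) (K : Fin n → ℕ) (g : DiffFun n m) :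
    shift i (Finsupp.single K g) = Finsupp.single (K + Pi.single i 1) g := by
  simp [shift]

theorem shift_apply_add (i : Fin n) (h : Jet n m) (K : Fin n → ℕ) :
    shift i h (K + Pi.single i 1) = h K :=
  Finsupp.mapDomain_apply (add_left_injective _) h K

theorem shift_apply_of_eq_zero {i : Fin n} (h : Jet n m) {K : Fin n → ℕ} (hK : K i = 0) :
    shift i h K = 0 := by
  refine Finsupp.mapDomain_of_notMem_range h K ?_
  rintro ⟨J, rfl⟩
  simp at hK

/-- Entrywise application of a linear map. -/
def entrywise (φ : DiffFun n m →ₗ[ℝ] DiffFun n m) : Jet n m →ₗ[ℝ] Jet n m :=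
  Finsupp.mapRange.linearMap φ

@[simp] theorem entrywise_apply (φ : DiffFun n m →ₗ[ℝ] DiffFun n m) (h : Jet n m)
    (K : Fin n → ℕ) : entrywise φ h K = φ (h K) := by
  simp [entrywise]

@[simp] theorem entrywise_single (φ : DiffFun n m →ₗ[ℝ] DiffFun n m) (K : Fin n → ℕ)
    (g : DiffFun n m) : entrywise φ (Finsupp.single K g) = Finsupp.single K (φ g) := by
  simp [entrywise]

theorem entrywise_shift (φ : DiffFun n m →ₗ[ℝ] DiffFun n m) (i : Fin n) (h : Jet n m) :
    entrywise φ (shift i h) = shift i (entrywise φ h) := by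
  induction h using Finsupp.induction_linear with
  | zero => simp
  | add f g hf hg => simp only [map_add, hf, hg]
  | single K g => simp

/-- `∑_I a_I h_I`. -/
abbrev lc (a : (Fin n → ℕ) → DiffFun n m) : Jet n m →ₗ[DiffFun n m] DiffFun n m :=
  Finsupp.linearCombination (DiffFun n m) a

theorem lc_shift (a : (Fin n → ℕ) → DiffFun n m) (i : Fin n) (h : Jet n m) :
    lc a (shift i h) = lc (fun I => a (I + Pi.single i 1)) h := by
  induction h using Finsupp.induction_linear with
  | zero => simp
  | add f g hf hg => simp only [map_add, hf, hg]
  | single K g => simp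

theorem derivation_lc (δ : Derivation ℝ (DiffFun n m) (DiffFun n m))
    (a : (Fin n → ℕ) → DiffFun n m) (h : Jet n m) :
    δ (lc a h) = lc (fun I => δ (a I)) h + lc a (entrywise δ h) := by
  induction h using Finsupp.induction_linear with
  | zero => simp
  | add f g hf hg => simp only [map_add, hf, hg]; ring
  | single K g => simp [mul_comm]

/-- The derivation `∑_{k,I} a^k_I ∂/∂u^k_I`. -/
def evol (a : Fin m → (Fin n → ℕ) → DiffFun n m) : Derivation ℝ (DiffFun n m) (DiffFun n m) :=
  ∑ k, (lc (a k)).compDer (dU k)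

theorem evol_apply (a : Fin m → (Fin n → ℕ) → DiffFun n m) (f : DiffFun n m) :
    evol a f = ∑ k, lc (a k) (dU k f) := by
  rw [evol, ← Derivation.coeFnAddMonoidHom_apply, map_sum, Finset.sum_apply]
  rfl

theorem evol_coe (a : Fin m → (Fin n → ℕ) → DiffFun n m) (f : DiffFun n m)
    (p : Coord n m → ℝ) : (evol a f : Fun n m) p =
      ∑ᶠ kI : Fin m × (Fin n → ℕ), (a kI.1 kI.2 : Fun n m) p * pd (.u kI.1 kI.2) f p := by
  have hfin : (Function.support fun kI : Fin m × (Fin n → ℕ) =>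
      (a kI.1 kI.2 : Fun n m) p * pd (.u kI.1 kI.2) f p).Finite := by
    refine ((finite_support_Pd f).preimage (f := fun kI : Fin m × (Fin n → ℕ) =>
      Coord.u kI.1 kI.2) fun I _ J _ h => ?_).subset fun kI h h0 => h ?_
    · rcases I with ⟨_, _⟩; rcases J with ⟨_, _⟩; cases h; rfl
    · change (a kI.1 kI.2 : Fun n m) p * (Pd (.u kI.1 kI.2) f : Fun n m) p = 0
      simp [h0]
  rw [finsum_curry _ hfin, finsum_eq_sum_of_fintype, evol_apply, DiffFun.sum_apply]
  refine Finset.sum_congr rfl fun k _ => ?_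
  rw [Finsupp.linearCombination_apply, Finsupp.sum, DiffFun.sum_apply, finsum_eq_sum_of_support_subset (s := (dU k f).support)]
  · refine Finset.sum_congr rfl fun I _ => ?_
    rw [smul_eq_mul, DiffFun.mul_apply, mul_comm]; rfl
  · intro I hI
    rw [Finset.mem_coe, Finsupp.mem_support_iff]
    intro h0
    refine hI ?_
    change (a k I : Fun n m) p * (dU k f I : Fun n m) p = 0
    simp [h0]

theorem Pd_evol (z : Coord n m) (a : Fin m → (Fin n → ℕ) → DiffFun n m) (f : DiffFun n m) :
    Pd z (evol a f) = evol a (Pd z f) + ∑ k, lc (fun I => Pd z (a k I)) (dU k f) := by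
  have : ∀ k, entrywise (Pd z) (dU k f) = dU k (Pd z f) := fun k =>
    Finsupp.ext fun I => by simp [Pd_comm z]
  rw [evol_apply, map_sum, evol_apply, ← Finset.sum_add_distrib]
  refine Finset.sum_congr rfl fun k _ => ?_
  rw [derivation_lc, this, add_comm]

theorem lc_dU_apply (k : Fin m) (a : (Fin n → ℕ) → DiffFun n m) (h : Jet n m)
    (K : Fin n → ℕ) : lc (fun I => Pd (.u k K) (a I)) h =
      Finsupp.linearCombination (DiffFun n m) (fun I => dU k (a I)) h K := by
  induction h using Finsupp.induction_linear with
  | zero => simp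
  | add f g hf hg => simp only [map_add, hf, hg, Finsupp.add_apply]
  | single K g => simp

theorem dU_evol (k : Fin m) (a : Fin m → (Fin n → ℕ) → DiffFun n m) (f : DiffFun n m) :
    dU k (evol a f) = entrywise (evol a) (dU k f) +
      ∑ j, Finsupp.linearCombination (DiffFun n m) (fun I => dU k (a j I)) (dU j f) := by
  ext1 K
  rw [Finsupp.add_apply, Finsupp.finsetSum_apply, dU_apply, Pd_evol]
  exact congrArg _ (Finset.sum_congr rfl fun j _ => lc_dU_apply k _ _ K)

/-! ### Total derivatives and their commutation -/

/-- The total derivative with respect to `x i` as a derivation. -/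
def X (i : Fin n) : Derivation ℝ (DiffFun n m) (DiffFun n m) :=
  Pd (.x i) + evol fun k I => coord (.u k (I + Pi.single i 1))

theorem X_apply (i : Fin n) (f : DiffFun n m) :
    X i f = Pd (.x i) f + evol (fun k I => coord (.u k (I + Pi.single i 1))) f := rfl

/-- The total derivatives as linear maps. -/
abbrev Xl (i : Fin n) : Module.End ℝ (DiffFun n m) := (X (m := m) i).toLinearMap

theorem coe_X (i : Fin n) (f : DiffFun n m) : (X i f : Fun n m) = Dx i f := by
  funext p
  exact congrArg (pd (.x i) f p + ·) (evol_coe _ f p)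

theorem Pd_X_of_ne_u {z : Coord n m} (hz : ∀ k I, z ≠ .u k I) (i : Fin n) (f : DiffFun n m) :
    Pd z (X i f) = X i (Pd z f) := by
  rw [X_apply, X_apply, map_add, Pd_evol, Pd_comm z]
  simp only [Pd_coord, hz, if_false]
  simp [Finsupp.linearCombination_apply]

/-- The commutator of ∂/∂u_K and D_i is ∂/∂u_{K-1_i}, or 0 if K_i = 0. Written for the whole family
it is a shift, and both cases merge without subtracting multi-indices. -/
theorem dU_X (k : Fin m) (i : Fin n) (f : DiffFun n m) :
    dU k (X i f) = entrywise (Xl i) (dU k f) + shift i (dU k f) := by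
  rw [X_apply, map_add, dU_evol, ← add_assoc]
  congr 1
  · ext1 K
    simp [X_apply, Pd_comm (.x i)]
  · have h1 : ∀ (j : Fin m) (I : Fin n → ℕ), dU k (coord (.u j (I + Pi.single i 1)) : DiffFun n m) =
        if k = j then (Finsupp.single (I + Pi.single i 1) 1 : Jet n m) else 0 := by
      intro j I
      ext1 K
      rw [dU_apply, Pd_coord]
      by_cases hk : k = j
      · subst hk
        by_cases hK : K = I + Pi.single i 1
        · simp [hK]
        · simp [hK]
      · simp [hk]
    simp only [h1]
    rw [Finset.sum_eq_single k]
    · simp only [if_true]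
      induction dU k f using Finsupp.induction_linear with
      | zero => simp
      | add f g hf hg => simp only [map_add, hf, hg]
      | single K g => simp
    · intro j _ hj
      simp [Ne.symm hj, Finsupp.linearCombination_apply]
    · simp

theorem Pd_X_add (k : Fin m) (i : Fin n) (K : Fin n → ℕ) (f : DiffFun n m) :
    Pd (.u k (K + Pi.single i 1)) (X i f) =
      X i (Pd (.u k (K + Pi.single i 1)) f) + Pd (.u k K) f := by
  have := DFunLike.congr_fun (dU_X k i f) (K + Pi.single i 1)
  simpa [shift_apply_add] using this

theorem Pd_X_of_eq_zero (k : Fin m) {i : Fin n} {K : Fin n → ℕ} (hK : K i = 0)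
    (f : DiffFun n m) : Pd (.u k K) (X i f) = X i (Pd (.u k K) f) := by
  have := DFunLike.congr_fun (dU_X k i f) K
  simpa [shift_apply_of_eq_zero _ hK] using this

/-- A vector field `∂/∂z + ∑ a^k_I ∂/∂u^k_I` with `a^k_{I+1_i} = D_i a^k_I` commutes with `D_i`. -/
theorem X_comm_of {z : Coord n m} (hz : ∀ k I, z ≠ .u k I) (i : Fin n)
    {a : Fin m → (Fin n → ℕ) → DiffFun n m} (ha : ∀ k I, X i (a k I) = a k (I + Pi.single i 1))
    (f : DiffFun n m) : X i (Pd z f + evol a f) = Pd z (X i f) + evol a (X i f) := by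
  rw [map_add, Pd_X_of_ne_u hz, evol_apply, map_sum, evol_apply]
  congr 1
  refine Finset.sum_congr rfl fun k _ => ?_
  rw [derivation_lc, dU_X, map_add, lc_shift]
  simp only [ha]
  rw [add_comm]

theorem X_comm (i j : Fin n) (f : DiffFun n m) : X i (X j f) = X j (X i f) := by
  refine X_comm_of (by simp) i (fun k I => ?_) f
  rw [X_apply, Pd_coord, if_neg (by simp), zero_add, evol_apply, Finset.sum_eq_single k]
  · have : dU k (coord (.u k (I + Pi.single j 1)) : DiffFun n m) =
        Finsupp.single (I + Pi.single j 1) 1 := by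
      ext1 K
      rw [dU_apply, Pd_coord]
      by_cases hK : K = I + Pi.single j 1
      · simp [hK]
      · simp [hK]
    rw [this]
    simp [add_right_comm]
  · intro l _ hl
    have : dU l (coord (.u k (I + Pi.single j 1)) : DiffFun n m) = 0 := by
      ext1 K
      simp [Pd_coord, hl]
    rw [this, map_zero]
  · simp

theorem Xl_commute (i j : Fin n) : Commute (Xl i : Module.End ℝ (DiffFun n m)) (Xl j) :=
  LinearMap.ext fun f => X_comm i j f

theorem negXl_commute (i j : Fin n) :
    Commute (-Xl i : Module.End ℝ (DiffFun n m)) (-Xl j) :=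
  LinearMap.ext fun f => by simp [X_comm i j]

/-- The iterated total derivatives as linear maps. -/
def XI (I : Fin n → ℕ) : Module.End ℝ (DiffFun n m) := mon Xl I

@[simp] theorem XI_zero (f : DiffFun n m) : XI 0 f = f := by simp [XI]

theorem XI_add_single (I : Fin n → ℕ) (i : Fin n) (f : DiffFun n m) :
    XI (I + Pi.single i 1) f = X i (XI I f) := by
  rw [XI, mon_add_single Xl_commute]; rfl

theorem coe_XI (I : Fin n → ℕ) (f : DiffFun n m) : (XI I f : Fun n m) = DxI I f := by
  have hp : ∀ (i : Fin n) (N : ℕ) (f : DiffFun n m),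
      (((Xl i ^ N) f : DiffFun n m) : Fun n m) = (Dx i)^[N] f := by
    intro i N f
    induction N with
    | zero => rfl
    | succ N ih => rw [pow_succ', Module.End.mul_apply, Function.iterate_succ_apply', ← ih]; exact coe_X i _
  have key : ∀ l : List (Fin n), (((l.map fun i => Xl i ^ I i).prod f : DiffFun n m) : Fun n m) =
      l.foldr (fun i h => (Dx i)^[I i] h) f := by
    intro l
    induction l with
    | nil => rfl
    | cons j l ih =>
      rw [List.map_cons, List.prod_cons, Module.End.mul_apply, hp, List.foldr_cons, ih]
  exact key _

/-- The total derivative with respect to `t` as a derivation. -/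
def T (F : Fin m → DiffFun n m) : Derivation ℝ (DiffFun n m) (DiffFun n m) :=
  Pd .t + evol fun k I => XI I (F k)

theorem T_apply (F : Fin m → DiffFun n m) (f : DiffFun n m) :
    T F f = Pd .t f + evol (fun k I => XI I (F k)) f := rfl

theorem coe_T (F : Fin m → DiffFun n m) (f : DiffFun n m) :
    (T F f : Fun n m) = Dt (fun k => (F k : Fun n m)) f := by
  funext p
  refine congrArg (pd .t f p + ·) ((evol_coe _ f p).trans ?_)
  simp only [coe_XI]

theorem X_T_comm (F : Fin m → DiffFun n m) (i : Fin n) (f : DiffFun n m) :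
    X i (T F f) = T F (X i f) :=
  X_comm_of (by simp) i (fun k I => (XI_add_single I i (F k)).symm) f

/-! ### Formal adjoints and the Euler operators -/

section Assemble

variable {M : Type} [AddCommGroup M] [Module ℝ M]

/-- `∑_K T^K (ι h_K)` for a family `T` of endomorphisms. -/
def assemble (T : Fin n → Module.End ℝ M) (ι : DiffFun n m →ₗ[ℝ] M) : Jet n m →ₗ[ℝ] M :=
  Finsupp.lsum ℝ fun K => mon T K ∘ₗ ι

@[simp] theorem assemble_single (T : Fin n → Module.End ℝ M) (ι : DiffFun n m →ₗ[ℝ] M)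
    (K : Fin n → ℕ) (g : DiffFun n m) :
    assemble T ι (Finsupp.single K g) = mon T K (ι g) := by
  simp [assemble]

theorem assemble_shift {T : Fin n → Module.End ℝ M} (hT : ∀ i j, Commute (T i) (T j))
    (ι : DiffFun n m →ₗ[ℝ] M) (i : Fin n) (h : Jet n m) :
    assemble T ι (shift i h) = T i (assemble T ι h) := by
  induction h using Finsupp.induction_linear with
  | zero => simp
  | add f g hf hg => simp only [map_add, hf, hg]
  | single K g => simp [mon_add_single hT]

theorem assemble_entrywise {T : Fin n → Module.End ℝ M} {ι : DiffFun n m →ₗ[ℝ] M}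
    {ψ : DiffFun n m →ₗ[ℝ] DiffFun n m} {φ : M →ₗ[ℝ] M} (hι : ∀ g, φ (ι g) = ι (ψ g))
    (hT : ∀ i x, φ (T i x) = T i (φ x)) (h : Jet n m) :
    assemble T ι (entrywise ψ h) = φ (assemble T ι h) := by
  induction h using Finsupp.induction_linear with
  | zero => simp
  | add f g hf hg => simp only [map_add, hf, hg]
  | single K g => simp [mon_intertwine φ hT, hι]

end Assemble

/-- `∑_K (-D)^K h_K`. -/
def adj : Jet n m →ₗ[ℝ] DiffFun n m := assemble (fun i => -Xl i) LinearMap.id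

theorem adj_shift (i : Fin n) (h : Jet n m) : adj (shift i h) = -X i (adj h) :=
  assemble_shift negXl_commute _ i h

theorem adj_entrywise (φ : DiffFun n m →ₗ[ℝ] DiffFun n m) (hφ : ∀ i f, φ (X i f) = X i (φ f))
    (h : Jet n m) : adj (entrywise φ h) = φ (adj h) :=
  assemble_entrywise (T := fun i => -Xl i) (ι := LinearMap.id) (ψ := φ) (φ := φ) (fun _ => rfl)
    (fun i x => by simp [hφ]) h

theorem adj_single_zero (g : DiffFun n m) : adj (Finsupp.single 0 g) = g := by
  simp [adj]

/-- The Euler operator `∑_I (-D)^I ∂/∂u^k_I`. -/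
def euler (k : Fin m) : DiffFun n m →ₗ[ℝ] DiffFun n m := adj ∘ₗ (dU (n := n) k).toLinearMap

theorem euler_apply (k : Fin m) (f : DiffFun n m) : euler k f = adj (dU k f) := rfl

/-- In `dU_X` the entrywise D_i and the shift become D_i and -D_i after applying `adj`. -/
theorem euler_X (k : Fin m) (i : Fin n) (f : DiffFun n m) : euler k (X i f) = 0 := by
  rw [euler_apply, dU_X, map_add, adj_shift, adj_entrywise (Xl i) (fun j f => X_comm i j f)]
  exact add_neg_cancel _

/-- By the Leibniz rule the two terms of `dU_X` cancel as in `euler_X`, except for the derivative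
falling on the multiplier. Iterated, this moves D^I off the linearized function and onto h as
(-D)^I. -/
theorem adj_smul_dU_X (k : Fin m) (i : Fin n) (g h : DiffFun n m) :
    adj (h • dU k (X i g)) = adj (-X i h • dU k g) := by
  have h1 : h • dU k (X i g) = entrywise (Xl i) (h • dU k g) + (-X i h) • dU k g +
      shift i (h • dU k g) := by
    rw [dU_X, smul_add, (shift i).map_smul]
    congr 1
    ext1 K
    simp only [Finsupp.smul_apply, Finsupp.add_apply, entrywise_apply, dU_apply, smul_eq_mul,
      Derivation.coeFn_coe, Derivation.leibniz]
    ring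
  rw [h1, map_add, map_add, adj_shift, adj_entrywise (Xl i) (fun j f => X_comm i j f)]
  simp

theorem adj_smul_dU_XI (k : Fin m) (I : Fin n → ℕ) (g h : DiffFun n m) :
    adj (h • dU k (XI I g)) = adj (mon (fun i => -Xl i) I h • dU k g) := by
  induction I using multiIndex_induction generalizing h with
  | h0 => simp
  | hs I i ih =>
    rw [XI_add_single, adj_smul_dU_X, ih, mon_add_single negXl_commute]
    congr 2
    exact (mon_intertwine (-Xl i) (fun j x => by simp [X_comm i j]) I h).symm

/-- The coefficients D^I F^j of D_t depend on the u^k_K themselves; moving D^I to the other factor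
assembles the derivatives of f into its Euler derivatives. -/
theorem euler_T (F : Fin m → DiffFun n m) (k : Fin m) (f : DiffFun n m) :
    euler k (T F f) = T F (euler k f) + ∑ j, adj (euler j f • dU k (F j)) := by
  have h1 : dU k (T F f) = entrywise (T F) (dU k f) +
      ∑ j, Finsupp.linearCombination (DiffFun n m) (fun I => dU k (XI I (F j))) (dU j f) := by
    rw [T_apply, map_add, dU_evol, ← add_assoc]
    congr 1
    ext1 K
    simp [T_apply, Pd_comm .t]
  rw [euler_apply, h1, map_add, adj_entrywise (T F) (fun i f => (X_T_comm F i f).symm), map_sum]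
  congr 1
  refine Finset.sum_congr rfl fun j _ => ?_
  rw [euler_apply]
  induction dU j f using Finsupp.induction_linear with
  | zero => simp
  | add f g hf hg => simp only [map_add, hf, hg, add_smul]
  | single K g =>
    rw [Finsupp.linearCombination_single, adj_smul_dU_XI]
    simp [adj]

theorem dU_coord (j k : Fin m) (I : Fin n → ℕ) : dU j (coord (.u k I) : DiffFun n m) =
    if j = k then (Finsupp.single I 1 : Jet n m) else 0 := by
  ext1 K
  rw [dU_apply, Pd_coord]
  by_cases hk : j = k
  · subst hk
    by_cases hK : K = I
    · simp [hK]
    · simp [hK]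
  · simp [hk]

theorem evol_coord (a : Fin m → (Fin n → ℕ) → DiffFun n m) (k : Fin m) (I : Fin n → ℕ) :
    evol a (coord (.u k I)) = a k I := by
  rw [evol_apply, Finset.sum_eq_single k]
  · simp [dU_coord]
  · intro j _ hj
    simp [dU_coord, hj]
  · simp

theorem X_coord (i : Fin n) (k : Fin m) (I : Fin n → ℕ) :
    X i (coord (.u k I) : DiffFun n m) = coord (.u k (I + Pi.single i 1)) := by
  rw [X_apply, Pd_coord, if_neg (by simp), zero_add, evol_coord]

/-! ### Functions of t and x alone; the homotopy formula in the dependent variables -/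

/-- Differential functions that depend on the independent variables only. -/
def UIndep (f : DiffFun n m) : Prop := ∀ k, dU k f = 0

theorem UIndep.evol {f : DiffFun n m} (hf : UIndep f)
    (a : Fin m → (Fin n → ℕ) → DiffFun n m) : evol a f = 0 := by
  rw [evol_apply]
  exact Finset.sum_eq_zero fun k _ => by rw [hf k, map_zero]

theorem UIndep.X {f : DiffFun n m} (hf : UIndep f) (i : Fin n) : X i f = Pd (.x i) f := by
  rw [X_apply, hf.evol, add_zero]

theorem UIndep.T {f : DiffFun n m} (hf : UIndep f) (F : Fin m → DiffFun n m) :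
    T F f = Pd .t f := by
  rw [T_apply, hf.evol, add_zero]

theorem UIndep.Pd {f : DiffFun n m} (hf : UIndep f) (z : Coord n m) : UIndep (Pd z f) := by
  intro k
  ext1 I
  rw [dU_apply, Pd_comm, ← dU_apply, hf k]
  simp

theorem UIndep.antideriv {f : DiffFun n m} (hf : UIndep f) {z : Coord n m}
    (hz : ∀ k I, Coord.u k I ≠ z) : UIndep (antideriv z f) := by
  intro k
  ext1 I
  rw [dU_apply, Pd_antideriv_of_ne (hz k I), ← dU_apply, hf k]
  simp [antideriv_zero]

/-- The coordinates `u^k_I`. -/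
def isU : Coord n m → Bool
  | .u _ _ => true
  | _ => false

theorem uIndep_atZero (f : DiffFun n m) : UIndep (atZero isU f) :=
  fun _ => Finsupp.ext fun _ => Pd_atZero isU f rfl

theorem lc_dU_eq_sum (k : Fin m) (a : (Fin n → ℕ) → DiffFun n m) (f : DiffFun n m)
    {S : Finset (Fin n → ℕ)} (hS : (dU k f).support ⊆ S) :
    lc a (dU k f) = ∑ I ∈ S, a I * Pd (.u k I) f := by
  rw [Finsupp.linearCombination_apply, Finsupp.sum_of_support_subset _ hS _ (by simp)]
  exact Finset.sum_congr rfl fun I _ => by rw [dU_apply, smul_eq_mul, mul_comm]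

/-- The parts u_{I+1_i} ∂/∂u_I of D_i are homogeneous of degree zero in u, and ∂/∂x_i does not
involve u. -/
theorem Avg_X (i : Fin n) (f : DiffFun n m) : Avg isU (X i f) = X i (Avg isU f) := by
  rw [X_apply, X_apply, map_add, Pd_Avg_of_not _ _ (by rfl), evol_apply, evol_apply, map_sum]
  congr 1
  refine Finset.sum_congr rfl fun k _ => ?_
  rw [lc_dU_eq_sum k _ f (S := (dU k f).support ∪ (dU k (Avg isU f)).support)
      Finset.subset_union_left,
    lc_dU_eq_sum k _ (Avg isU f) (S := (dU k f).support ∪ (dU k (Avg isU f)).support)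
      Finset.subset_union_right, map_sum]
  exact Finset.sum_congr rfl fun I _ => (coord_mul_Pd_Avg _ _ (by rfl) (by rfl)).symm

/-- `∑_I u^k_I h_I`. -/
abbrev mu (k : Fin m) : Jet n m →ₗ[DiffFun n m] DiffFun n m := lc fun I => coord (.u k I)

theorem sub_atZero_isU (f : DiffFun n m) :
    f - atZero isU f = ∑ k, mu k (entrywise (Avg isU) (dU k f)) := by
  classical
  set S : Finset (Coord n m) := Finset.univ.biUnion fun k => (dU k f).support.image (.u k)
  rw [sub_atZero isU f S]
  · rw [Finset.filter_true_of_mem, Finset.sum_biUnion]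
    · refine Finset.sum_congr rfl fun k _ => ?_
      rw [Finset.sum_image fun I _ J _ h => by cases h; rfl, Finsupp.linearCombination_apply,
        Finsupp.sum_of_support_subset (s := (dU k f).support)]
      · exact Finset.sum_congr rfl fun I _ => by
          rw [entrywise_apply, dU_apply, smul_eq_mul, mul_comm]
      · intro I hI
        rw [Finsupp.mem_support_iff] at hI ⊢
        intro h
        exact hI (by rw [entrywise_apply, h, map_zero])
      · simp
    · intro j _ k _ hjk
      rw [Function.onFun, Finset.disjoint_left]
      intro z hz hz'
      obtain ⟨I, _, rfl⟩ := Finset.mem_image.1 hz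
      obtain ⟨K, _, h⟩ := Finset.mem_image.1 hz'
      cases h
      exact hjk rfl
    · intro z hz
      obtain ⟨k, _, hz⟩ := Finset.mem_biUnion.1 hz
      obtain ⟨I, _, rfl⟩ := Finset.mem_image.1 hz
      rfl
  · rintro (_ | _ | ⟨k, I⟩) hz hzS
    · cases hz
    · cases hz
    · by_contra h
      exact hzS (Finset.mem_biUnion.2 ⟨k, Finset.mem_univ k,
        Finset.mem_image_of_mem _ (Finsupp.mem_support_iff.2 h)⟩)

/-! ### Integration by parts in a set of directions -/

/-- Integration by parts in the directions of `A`, shift in the other directions. -/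
def byParts (A : Finset (Fin n)) (i : Fin n) : Module.End ℝ (Jet n m) :=
  if i ∈ A then -entrywise (Xl i) else (shift i).restrictScalars ℝ

theorem byParts_of_mem {A : Finset (Fin n)} {i : Fin n} (h : i ∈ A) (e : Jet n m) :
    byParts A i e = -entrywise (Xl i) e := by
  simp [byParts, h]

theorem byParts_of_notMem {A : Finset (Fin n)} {i : Fin n} (h : i ∉ A) (e : Jet n m) :
    byParts A i e = shift i e := by
  simp [byParts, h]

theorem shift_comm (i j : Fin n) (h : Jet n m) : shift i (shift j h) = shift j (shift i h) := by
  induction h using Finsupp.induction_linear with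
  | zero => simp
  | add f g hf hg => simp only [map_add, hf, hg]
  | single K g => simp [add_right_comm]

theorem byParts_entrywise (A : Finset (Fin n)) {φ : DiffFun n m →ₗ[ℝ] DiffFun n m}
    (hφ : ∀ i f, φ (X i f) = X i (φ f)) (i : Fin n) (e : Jet n m) :
    entrywise φ (byParts A i e) = byParts A i (entrywise φ e) := by
  by_cases h : i ∈ A
  · rw [byParts_of_mem h, byParts_of_mem h, map_neg]
    congr 1
    ext1 K
    simp [hφ]
  · rw [byParts_of_notMem h, byParts_of_notMem h, entrywise_shift]

theorem byParts_commute_shift (A : Finset (Fin n)) (i j : Fin n) (e : Jet n m) :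
    byParts A i (shift j e) = shift j (byParts A i e) := by
  by_cases h : i ∈ A
  · rw [byParts_of_mem h, byParts_of_mem h, map_neg, entrywise_shift]
  · rw [byParts_of_notMem h, byParts_of_notMem h, shift_comm]

theorem byParts_commute (A : Finset (Fin n)) (i j : Fin n) :
    Commute (byParts A i : Module.End ℝ (Jet n m)) (byParts A j) := by
  refine LinearMap.ext fun e => ?_
  change byParts A i (byParts A j e) = byParts A j (byParts A i e)
  by_cases h : j ∈ A
  · rw [byParts_of_mem h, byParts_of_mem h, map_neg,
      byParts_entrywise A (φ := Xl j) (fun i f => X_comm j i f)]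
  · rw [byParts_of_notMem h, byParts_of_notMem h, byParts_commute_shift]

/-- `∑_K (-D)^{K_A} h_K` placed at the part of `K` outside `A`. -/
def partialAdj (A : Finset (Fin n)) : Jet n m →ₗ[ℝ] Jet n m :=
  assemble (byParts A) (Finsupp.lsingle 0)

theorem partialAdj_shift (A : Finset (Fin n)) (i : Fin n) (h : Jet n m) :
    partialAdj A (shift i h) = byParts A i (partialAdj A h) :=
  assemble_shift (byParts_commute A) _ i h

theorem partialAdj_entrywise (A : Finset (Fin n)) {φ : DiffFun n m →ₗ[ℝ] DiffFun n m}
    (hφ : ∀ i f, φ (X i f) = X i (φ f)) (h : Jet n m) :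
    partialAdj A (entrywise φ h) = entrywise φ (partialAdj A h) :=
  assemble_entrywise (fun g => by simp) (byParts_entrywise A hφ) h

theorem partialAdj_univ (h : Jet n m) : partialAdj Finset.univ h = Finsupp.single 0 (adj h) := by
  induction h using Finsupp.induction_linear with
  | zero => simp
  | add f g hf hg => simp only [map_add, hf, hg, Finsupp.single_add]
  | single K g =>
    rw [partialAdj, assemble_single, adj, assemble_single]
    exact (mon_intertwine (T := fun i => -Xl i) (T' := byParts Finset.univ)
      (Finsupp.lsingle (R := ℝ) 0) (fun i x => by
        rw [byParts_of_mem (Finset.mem_univ i)]; simp) K g).symm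

/-- The sums `∑_{i ∈ A} D_i P_i`. -/
def divs (A : Finset (Fin n)) : Submodule ℝ (DiffFun n m) :=
  LinearMap.range (∑ i ∈ A, Xl i ∘ₗ LinearMap.proj (R := ℝ) (φ := fun _ => DiffFun n m) i)

theorem mem_divs {A : Finset (Fin n)} {f : DiffFun n m} :
    f ∈ divs A ↔ ∃ P : Fin n → DiffFun n m, ∑ i ∈ A, X i (P i) = f := by
  simp [divs, LinearMap.mem_range, LinearMap.sum_apply]

theorem X_mem_divs {A : Finset (Fin n)} {i : Fin n} (h : i ∈ A) (f : DiffFun n m) :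
    X i f ∈ divs A := by
  refine mem_divs.2 ⟨Pi.single i f, ?_⟩
  rw [Finset.sum_eq_single_of_mem i h, Pi.single_eq_same]
  intro j _ hj
  rw [Pi.single_eq_of_ne hj, map_zero]

/-- The product rule u_{K+1_i} h = D_i(u_K h) - u_K D_i h, used only for i in A. -/
theorem mu_byParts (A : Finset (Fin n)) (k : Fin m) (i : Fin n) (e : Jet n m) :
    mu k (byParts A i e) - mu k (shift i e) ∈ divs A := by
  by_cases h : i ∈ A
  · have : mu k (byParts A i e) - mu k (shift i e) = -X i (mu k e) := by
      rw [byParts_of_mem h, derivation_lc, lc_shift, map_neg]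
      simp only [X_coord]
      ring
    rw [this]
    exact (divs A).neg_mem (X_mem_divs h _)
  · rw [byParts_of_notMem h, sub_self]
    exact (divs A).zero_mem

theorem mu_mon_byParts (A : Finset (Fin n)) (k : Fin m) (K : Fin n → ℕ) (g : DiffFun n m) :
    ∀ J, mu k (mon (byParts A) K (Finsupp.single J g)) - mu k (Finsupp.single (J + K) g) ∈
      divs A := by
  induction K using multiIndex_induction with
  | h0 => intro J; simp
  | hs K i ih =>
    intro J
    have h1 := mu_byParts A k i (mon (byParts A) K (Finsupp.single J g))
    -- The new shift is absorbed into the starting index, which is why `J` has to vary in the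
    -- induction.
    have h2 := ih (J + Pi.single i 1)
    have h4 : mon (byParts A) K (shift i (Finsupp.single J g)) =
        shift i (mon (byParts A) K (Finsupp.single J g)) :=
      (mon_intertwine (T := byParts A) ((shift i).restrictScalars ℝ)
        (fun j x => (byParts_commute_shift A j i x).symm) K _).symm
    rw [← shift_single, h4] at h2
    rw [mon_add_single (byParts_commute A)]
    have h3 := (divs A).add_mem h1 h2
    rw [add_right_comm, add_assoc] at h3
    simpa using h3

theorem mu_partialAdj (A : Finset (Fin n)) (k : Fin m) (h : Jet n m) :
    mu k h - mu k (partialAdj A h) ∈ divs A := by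
  induction h using Finsupp.induction_linear with
  | zero => simp
  | add f g hf hg =>
    have := (divs A).add_mem hf hg
    rwa [← add_sub_add_comm, ← map_add, ← map_add, ← map_add] at this
  | single K g =>
    have := (divs A).neg_mem (mu_mon_byParts A k K g 0)
    rw [neg_sub, zero_add] at this
    rwa [partialAdj, assemble_single]

/-- Averaging commutes with the D_i, hence with `partialAdj`, so the vanishing passes to the
averaged family in the homotopy formula; integration by parts then leaves only divergences. For A
all directions the hypothesis is the vanishing of the Euler operators. -/
theorem sub_atZero_mem_divs {A : Finset (Fin n)} {f : DiffFun n m}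
    (h : ∀ k, partialAdj A (dU k f) = 0) : f - atZero isU f ∈ divs A := by
  rw [sub_atZero_isU]
  refine (divs A).sum_mem fun k _ => ?_
  have := mu_partialAdj A k (entrywise (Avg isU) (dU k f))
  rwa [partialAdj_entrywise A Avg_X, h k, map_zero, map_zero, sub_zero] at this

theorem partialAdj_dU_X (A : Finset (Fin n)) (k : Fin m) (i : Fin n) (f : DiffFun n m) :
    partialAdj A (dU k (X i f)) = entrywise (Xl i) (partialAdj A (dU k f)) +
      byParts A i (partialAdj A (dU k f)) := by
  rw [dU_X, map_add, partialAdj_shift, partialAdj_entrywise A (φ := Xl i) (X_comm i)]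

theorem partialAdj_dU_of_mem_divs {A : Finset (Fin n)} {f : DiffFun n m} (hf : f ∈ divs A)
    (k : Fin m) : partialAdj A (dU k f) = 0 := by
  obtain ⟨P, rfl⟩ := mem_divs.1 hf
  rw [map_sum, map_sum]
  refine Finset.sum_eq_zero fun i hi => ?_
  rw [partialAdj_dU_X, byParts_of_mem hi]
  exact add_neg_cancel _

/-- The entry at K + 1_i reads D_i e_{K+1_i} + e_K = 0, so zeros propagate downwards in direction i,
starting outside the finite support. -/
theorem eq_zero_of_entrywise_add_shift {i : Fin n} {e : Jet n m}
    (he : entrywise (Xl i) e + shift i e = 0) : e = 0 := by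
  have hstep : ∀ K, e (K + Pi.single i 1) = 0 → e K = 0 := by
    intro K hK
    have := DFunLike.congr_fun he (K + Pi.single i 1)
    rw [Finsupp.add_apply, shift_apply_add, entrywise_apply, hK] at this
    simpa using this
  have hN : ∀ (N : ℕ) K, e (K + Pi.single i N) = 0 → e K = 0 := by
    intro N
    induction N with
    | zero => intro K hK; simpa using hK
    | succ N ih =>
      intro K hK
      refine ih K (hstep _ ?_)
      rwa [add_assoc, ← Pi.single_add]
  ext1 K
  by_contra hK
  obtain ⟨N, hNe⟩ := Set.Infinite.exists_notMem_finset
    (Set.infinite_range_of_injective (f := fun N : ℕ => K + Pi.single i N)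
      ((add_right_injective K).comp (Pi.single_injective (M := fun _ => ℕ) i))) e.support
  obtain ⟨⟨N', rfl⟩, hNe⟩ := hNe
  exact hK (hN N' K (Finsupp.notMem_support_iff.1 hNe))

/-- Since i is outside A, D_i f enters `partialAdj` through D_i plus the shift, which is injective
on finitely supported families. This is how D_i is cancelled modulo divergences in the other
directions. -/
theorem partialAdj_dU_eq_zero_of_X_mem {A : Finset (Fin n)} {i : Fin n} (hi : i ∉ A)
    {f : DiffFun n m} (hf : X i f ∈ divs A) (k : Fin m) : partialAdj A (dU k f) = 0 := by
  have := partialAdj_dU_of_mem_divs hf k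
  rw [partialAdj_dU_X, byParts_of_notMem hi] at this
  exact eq_zero_of_entrywise_add_shift this

theorem UIndep.mem_divs {f : DiffFun n m} (hf : UIndep f) {A : Finset (Fin n)}
    (hA : A.Nonempty) : f ∈ divs A := by
  obtain ⟨i, hi⟩ := hA
  have := X_mem_divs hi (Brusselator.antideriv (.x i) f)
  rwa [(hf.antideriv (z := .x i) (by simp)).X, Pd_antideriv_self] at this

/-! ### Currents with vanishing Euler derivatives are trivial -/

/-- Exactness of the horizontal complex at currents without density. -/
theorem exists_potential_of_divergence_free (F : Fin m → DiffFun n m) (A : Finset (Fin n))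
    (hA : A.Nonempty) (J : Fin n → DiffFun n m) (h : ∑ i ∈ A, X i (J i) = 0) :
    ∃ (L : Fin n → Fin n → DiffFun n m) (Q : Fin n → DiffFun n m),
      (∀ i j, L i j = -L j i) ∧ ∑ i ∈ A, X i (Q i) = 0 ∧
      ∀ i ∈ A, J i = T F (Q i) + ∑ l ∈ A, X l (L l i) := by
  classical
  induction hA using Finset.Nonempty.cons_induction generalizing J with
  | singleton i =>
    rw [Finset.sum_singleton] at h
    have h0 := sub_atZero_mem_divs (partialAdj_dU_eq_zero_of_X_mem (Finset.notMem_empty i)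
      (h ▸ (divs ∅).zero_mem))
    obtain ⟨P, hP⟩ := mem_divs.1 h0
    rw [Finset.sum_empty, eq_comm, sub_eq_zero] at hP
    have hu : UIndep (J i) := hP ▸ uIndep_atZero (J i)
    -- In a single direction no antisymmetric potential is available; the remaining function of t
    -- and x is a time derivative instead. This is the reason for the term `T F (Q i)`.
    have hQ : UIndep (antideriv .t (J i)) := hu.antideriv (by simp)
    refine ⟨0, fun _ => antideriv .t (J i), by simp, ?_, ?_⟩
    · rw [Finset.sum_singleton, hQ.X, Pd_antideriv_of_ne (by simp), ← hu.X, h, antideriv_zero]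
    · intro j hj
      rw [Finset.mem_singleton.1 hj, hQ.T, Pd_antideriv_self]
      simp
  | cons i A hi hA ih =>
    rw [Finset.sum_cons] at h
    have h1 : X i (J i) ∈ divs A := by
      rw [eq_neg_of_add_eq_zero_left h]
      exact (divs A).neg_mem (mem_divs.2 ⟨J, rfl⟩)
    have h2 : J i ∈ divs A := by
      have := (divs A).add_mem (sub_atZero_mem_divs (partialAdj_dU_eq_zero_of_X_mem hi h1))
        ((uIndep_atZero (J i)).mem_divs hA)
      rwa [sub_add_cancel] at this
    obtain ⟨P, hP⟩ := mem_divs.1 h2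
    -- As J_i = Σ_{l ∈ A} D_l P_l, adding D_i P_l to each J_l accounts for D_i J_i and leaves a
    -- current without divergence in the directions of A.
    obtain ⟨L, Q, hL, hQ, hJ⟩ := ih (fun l => J l + X i (P l)) (by
      simp only [map_add, Finset.sum_add_distrib]
      rw [← h, ← hP, map_sum, add_comm]
      congr 1
      exact Finset.sum_congr rfl fun l _ => X_comm l i _)
    have hne : ∀ l ∈ A, l ≠ i := fun l hl e => hi (e ▸ hl)
    refine ⟨fun a b => if a = i then (if b = i then 0 else -P b) else if b = i then P a else L a b,
      fun j => if j = i then 0 else Q j, ?_, ?_, ?_⟩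
    · intro a b
      by_cases ha : a = i <;> by_cases hb : b = i <;> simp [ha, hb]
      exact hL a b
    · simp only [Finset.sum_cons, if_true]
      rw [map_zero, zero_add, ← hQ]
      exact Finset.sum_congr rfl fun l hl => by rw [if_neg (hne l hl)]
    · intro j hj
      rw [Finset.sum_cons]
      rcases Finset.mem_cons.1 hj with rfl | hj
      · simp only [if_true, map_zero, zero_add]
        rw [← hP]
        exact Finset.sum_congr rfl fun l hl => by rw [if_neg (hne l hl)]
      · simp only [if_true, if_neg (hne j hj), map_neg]
        have : ∑ l ∈ A, X l (if l = i then -P j else L l j) = ∑ l ∈ A, X l (L l j) :=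
          Finset.sum_congr rfl fun l hl => by rw [if_neg (hne l hl)]
        rw [this, add_left_comm, ← hJ j hj]
        ring

/-- A conserved current whose density is annihilated by the Euler operators is trivial. -/
theorem exists_potential (F : Fin m → DiffFun n m) (hn : 1 ≤ n) (J₀ : DiffFun n m)
    (J : Fin n → DiffFun n m) (hJ : T F J₀ + ∑ i, X i (J i) = 0) (he : ∀ k, euler k J₀ = 0) :
    ∃ (P : Fin n → DiffFun n m) (L : Fin n → Fin n → DiffFun n m),
      J₀ = -∑ i, X i (P i) ∧ ∀ i, J i = T F (P i) +
        (∑ l ∈ Finset.Iio i, X l (L l i) - ∑ l ∈ Finset.Ioi i, X l (L i l)) := by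
  have hne : (Finset.univ : Finset (Fin n)).Nonempty := ⟨⟨0, hn⟩, Finset.mem_univ _⟩
  have h0 : J₀ ∈ divs Finset.univ := by
    have := (divs Finset.univ).add_mem (sub_atZero_mem_divs (A := Finset.univ) (f := J₀) fun k => by
      rw [partialAdj_univ, ← euler_apply, he, Finsupp.single_zero])
      ((uIndep_atZero J₀).mem_divs hne)
    rwa [sub_add_cancel] at this
  obtain ⟨P, hP⟩ := mem_divs.1 h0
  -- Since J_0 = Σ D_i P_i and D_t commutes with D_i, the components J_i + D_t P_i have zero
  -- divergence.
  obtain ⟨L, Q, hL, hQ, hJ'⟩ := exists_potential_of_divergence_free F Finset.univ hne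
    (fun i => J i + T F (P i)) (by
      simp only [map_add, Finset.sum_add_distrib]
      rw [← hJ, ← hP, map_sum, add_comm]
      congr 1
      exact Finset.sum_congr rfl fun l _ => X_T_comm F l _)
  refine ⟨Q - P, L, ?_, fun i => ?_⟩
  · simp only [Pi.sub_apply, map_sub, Finset.sum_sub_distrib, hQ, hP]
    ring
  · have h1 := hJ' i (Finset.mem_univ i)
    have hii : L i i = 0 := DiffFun.ext fun p => by
      have := congrArg (fun f : DiffFun n m => (f : Fun n m) p) (hL i i)
      simp only [DiffFun.neg_apply] at this
      rw [DiffFun.zero_apply]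
      linarith
    have h2 : ∑ l, X l (L l i) =
        ∑ l ∈ Finset.Iio i, X l (L l i) - ∑ l ∈ Finset.Ioi i, X l (L i l) := by
      have h3 : (Finset.univ : Finset (Fin n)).erase i = Finset.Iio i ∪ Finset.Ioi i := by
        ext l
        simp [lt_or_lt_iff_ne]
      rw [← Finset.add_sum_erase _ _ (Finset.mem_univ i), hii, map_zero, zero_add, h3,
        Finset.sum_union (Finset.disjoint_left.2 fun l h h' =>
          (Finset.mem_Iio.1 h).asymm (Finset.mem_Ioi.1 h')), sub_eq_add_neg,
        ← Finset.sum_neg_distrib]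
      congr 1
      exact Finset.sum_congr rfl fun l _ => by rw [hL l i, map_neg]
    rw [← h2, Pi.sub_apply, map_sub]
    linear_combination h1

/-! ### The filtration by order of derivatives -/

theorem sum_add_single (K : Fin n → ℕ) (i : Fin n) :
    ∑ j, (K + Pi.single i 1 : Fin n → ℕ) j = ∑ j, K j + 1 := by
  simp [Finset.sum_add_distrib]

theorem eq_zero_or_exists_add_single (K : Fin n → ℕ) (i : Fin n) :
    K i = 0 ∨ ∃ K' : Fin n → ℕ, K = K' + Pi.single i 1 := by
  rcases Nat.eq_zero_or_pos (K i) with h | h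
  · exact Or.inl h
  · refine Or.inr ⟨K - Pi.single i 1, ?_⟩
    funext j
    by_cases hj : j = i
    · subst hj; simp; omega
    · simp [hj]

theorem shift_eq_zero_or (i : Fin n) (h : Jet n m) (K : Fin n → ℕ) :
    shift i h K = 0 ∨ ∃ K' : Fin n → ℕ, K = K' + Pi.single i 1 ∧ shift i h K = h K' := by
  rcases eq_zero_or_exists_add_single K i with hK | ⟨K', rfl⟩
  · exact Or.inl (shift_apply_of_eq_zero h hK)
  · exact Or.inr ⟨K', rfl, shift_apply_add i h K'⟩

/-- `f` does not depend on the derivatives of order at least `r`. -/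
def OrdLt (r : ℕ) (f : DiffFun n m) : Prop :=
  ∀ k (K : Fin n → ℕ), r ≤ ∑ i, K i → Pd (.u k K) f = 0

namespace OrdLt

variable {r s : ℕ} {f g : DiffFun n m}

theorem mono (hf : OrdLt r f) (h : r ≤ s) : OrdLt s f := fun k K hK => hf k K (h.trans hK)

theorem add (hf : OrdLt r f) (hg : OrdLt r g) : OrdLt r (f + g) := fun k K hK => by
  rw [map_add, hf k K hK, hg k K hK, add_zero]

theorem neg (hf : OrdLt r f) : OrdLt r (-f) := fun k K hK => by
  rw [map_neg, hf k K hK, neg_zero]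

theorem sub (hf : OrdLt r f) (hg : OrdLt r g) : OrdLt r (f - g) := by
  rw [sub_eq_add_neg]; exact hf.add hg.neg

theorem mul (hf : OrdLt r f) (hg : OrdLt r g) : OrdLt r (f * g) := fun k K hK => by
  rw [Derivation.leibniz, hf k K hK, hg k K hK, smul_zero, smul_zero, add_zero]

theorem pow (hf : OrdLt r f) (N : ℕ) : OrdLt r (f ^ N) := fun k K hK => by
  rw [Derivation.leibniz_pow, hf k K hK, smul_zero, smul_zero]

theorem const (c : ℝ) : OrdLt r (algebraMap ℝ (DiffFun n m) c) := fun _ _ _ =>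
  Derivation.map_algebraMap _ c

theorem zero : OrdLt r (0 : DiffFun n m) := fun _ _ _ => map_zero _

theorem sum {α : Type} {A : Finset α} {f : α → DiffFun n m} (hf : ∀ a ∈ A, OrdLt r (f a)) :
    OrdLt r (∑ a ∈ A, f a) := fun k K hK => by
  rw [map_sum]
  exact Finset.sum_eq_zero fun a ha => hf a ha k K hK

theorem coord_zero (k : Fin m) : OrdLt 1 (coord (.u k 0) : DiffFun n m) := fun j K hK => by
  rw [Pd_coord, if_neg]
  rintro h
  cases h
  simp at hK

theorem X (hf : OrdLt r f) (i : Fin n) : OrdLt (r + 1) (X i f) := fun k K hK => by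
  rcases eq_zero_or_exists_add_single K i with h | ⟨K', rfl⟩
  · rw [Pd_X_of_eq_zero k h, hf k K (by omega), map_zero]
  · rw [sum_add_single] at hK
    rw [Pd_X_add, hf k K' (by omega), hf k _ (by rw [sum_add_single]; omega), map_zero, add_zero]

theorem XI (hf : OrdLt r f) (J : Fin n → ℕ) : OrdLt (r + ∑ i, J i) (XI J f) := by
  induction J using multiIndex_induction with
  | h0 => simpa using hf
  | hs J i ih =>
    rw [XI_add_single, sum_add_single]
    exact ih.X i

theorem exists_of (f : DiffFun n m) : ∃ r, OrdLt r f := by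
  classical
  refine ⟨∑ k, ∑ K ∈ (dU k f).support, (∑ i, K i + 1), fun k K hK => ?_⟩
  by_contra h
  have h1 : ∑ i, K i + 1 ≤ ∑ K ∈ (dU k f).support, (∑ i, K i + 1) :=
    Finset.single_le_sum (f := fun K : Fin n → ℕ => ∑ i, K i + 1) (fun _ _ => Nat.zero_le _)
      (Finsupp.mem_support_iff.2 h)
  have h2 : ∑ K ∈ (dU k f).support, (∑ i, K i + 1) ≤
      ∑ k, ∑ K ∈ (dU k f).support, (∑ i, K i + 1) :=
    Finset.single_le_sum (f := fun k => ∑ K ∈ (dU k f).support, (∑ i, K i + 1))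
      (fun _ _ => Nat.zero_le _) (Finset.mem_univ k)
  omega

end OrdLt

theorem ordLt_zero_iff {f : DiffFun n m} : OrdLt 0 f ↔ UIndep f :=
  ⟨fun h k => Finsupp.ext fun K => h k K (Nat.zero_le _),
    fun h k K _ => by rw [← dU_apply, h k]; rfl⟩

theorem UIndep.ordLt {f : DiffFun n m} (hf : UIndep f) (r : ℕ) : OrdLt r f :=
  (ordLt_zero_iff.2 hf).mono (Nat.zero_le r)

theorem UIndep.Pd_u {f : DiffFun n m} (hf : UIndep f) (k : Fin m) (K : Fin n → ℕ) :
    Brusselator.Pd (.u k K) f = 0 := ordLt_zero_iff.2 hf k K (Nat.zero_le _)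

/-- Each D_i raises the order by one and acts on the top coefficients as a shift, starting from
∂g/∂u^k at the index 0. -/
theorem Pd_XI_top {g : DiffFun n m} (hg : OrdLt 1 g) (k : Fin m) (J : Fin n → ℕ) :
    ∀ K : Fin n → ℕ, ∑ i, K i = ∑ i, J i →
      Pd (.u k K) (XI J g) = if J = K then Pd (.u k 0) g else 0 := by
  induction J using multiIndex_induction with
  | h0 =>
    intro K hK
    have : K = 0 := by
      funext i
      simpa using (Finset.sum_eq_zero_iff.1 (hK.trans (by simp))) i (Finset.mem_univ i)
    simp [this]
  | hs J i ih =>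
    intro K hK
    rw [sum_add_single] at hK
    rw [XI_add_single]
    have h0 : Pd (.u k K) (XI J g) = 0 := hg.XI J k K (by omega)
    rcases eq_zero_or_exists_add_single K i with h | ⟨K', rfl⟩
    · rw [Pd_X_of_eq_zero k h, h0, map_zero, if_neg]
      rintro rfl
      simp at h
    · rw [sum_add_single] at hK
      rw [Pd_X_add, h0, map_zero, zero_add, ih K' (by omega)]
      simp

theorem lc_congr {a a' : (Fin n → ℕ) → DiffFun n m} {h : Jet n m}
    (ha : ∀ I, h I ≠ 0 → a I = a' I) : lc a h = lc a' h := by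
  rw [Finsupp.linearCombination_apply, Finsupp.linearCombination_apply]
  exact Finsupp.sum_congr fun I hI => by rw [ha I (Finsupp.mem_support_iff.1 hI)]

theorem lc_ite_eq (a : DiffFun n m) (K : Fin n → ℕ) (h : Jet n m) :
    lc (fun J => if J = K then a else 0) h = a * h K := by
  induction h using Finsupp.induction_linear with
  | zero => simp
  | add f g hf hg => rw [map_add, hf, hg, Finsupp.add_apply, mul_add]
  | single J h =>
    by_cases hJ : J = K
    · simp [hJ, mul_comm]
    · simp [hJ]

theorem derivation_const_mul (δ : Derivation ℝ (DiffFun n m) (DiffFun n m)) (c : ℝ)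
    (f : DiffFun n m) : δ (algebraMap ℝ _ c * f) = algebraMap ℝ _ c * δ f := by
  rw [← Algebra.smul_def, δ.map_smul, Algebra.smul_def]

/-! ### The Laplacian and reaction-diffusion systems -/

/-- `∑_i D_i^2`. -/
def lap : DiffFun n m →ₗ[ℝ] DiffFun n m := ∑ i, Xl i ∘ₗ Xl i

theorem lap_apply (f : DiffFun n m) : lap f = ∑ i, X i (X i f) := by
  simp [lap, LinearMap.sum_apply]

/-- On families of derivatives D_i acts as D_i plus the shift; the three terms are those of the
square. -/
theorem Pd_lap (k : Fin m) (K : Fin n → ℕ) (f : DiffFun n m) :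
    Pd (.u k K) (lap f) = lap (Pd (.u k K) f) + 2 * ∑ i, X i (shift i (dU k f) K) +
      ∑ i, shift i (shift i (dU k f)) K := by
  rw [lap_apply, lap_apply, map_sum, Finset.mul_sum, ← Finset.sum_add_distrib,
    ← Finset.sum_add_distrib]
  refine Finset.sum_congr rfl fun i _ => ?_
  rw [← dU_apply, dU_X, dU_X, map_add, map_add, ← entrywise_shift]
  simp only [Finsupp.add_apply, entrywise_apply, dU_apply, Derivation.coeFn_coe]
  ring

theorem Pd_T (F : Fin m → DiffFun n m) (k : Fin m) (K : Fin n → ℕ) (f : DiffFun n m) :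
    Pd (.u k K) (T F f) = T F (Pd (.u k K) f) +
      ∑ j, lc (fun J => Pd (.u k K) (XI J (F j))) (dU j f) := by
  rw [T_apply, T_apply, map_add, Pd_evol, Pd_comm _ .t, add_assoc]

theorem XI_coord (k : Fin m) (J K : Fin n → ℕ) :
    XI J (coord (.u k K) : DiffFun n m) = coord (.u k (K + J)) := by
  induction J using multiIndex_induction with
  | h0 => simp
  | hs J i ih => rw [XI_add_single, ih, X_coord, add_assoc]

theorem lc_Pd_lap (j k : Fin m) (K : Fin n → ℕ) (h : Jet n m) :
    lc (fun J => Pd (.u k K) (XI J (lap (coord (.u j 0))))) h =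
      if k = j then ∑ i, shift i (shift i h) K else 0 := by
  have h1 : ∀ J : Fin n → ℕ, XI J (lap (coord (.u j 0)) : DiffFun n m) =
      ∑ i, coord (.u j (J + Pi.single i 1 + Pi.single i 1)) := by
    intro J
    rw [lap_apply, map_sum]
    refine Finset.sum_congr rfl fun i _ => ?_
    rw [X_coord, X_coord, XI_coord, zero_add]
    congr 2
    abel
  simp only [h1, map_sum, Pd_coord]
  induction h using Finsupp.induction_linear with
  | zero => simp
  | add f g hf hg =>
    rw [map_add, hf, hg]
    split_ifs
    · simp [Finset.sum_add_distrib]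
    · simp
  | single J g =>
    rw [Finsupp.linearCombination_single]
    by_cases hk : k = j
    · simp only [hk, if_true, shift_single, Finsupp.single_apply, eq_comm (a := K),
        Coord.u.injEq, true_and, smul_eq_mul, Finset.mul_sum, mul_ite, mul_one, mul_zero]
    · simp [hk]

/-- Reaction-diffusion right-hand sides. -/
def reactionDiffusion (d : Fin m → ℝ) (g : Fin m → DiffFun n m) (k : Fin m) : DiffFun n m :=
  algebraMap ℝ _ (d k) * lap (coord (.u k 0)) + g k

theorem Pd_T_reactionDiffusion (d : Fin m → ℝ) (g : Fin m → DiffFun n m) (k : Fin m)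
    (K : Fin n → ℕ) (f : DiffFun n m) :
    Pd (.u k K) (T (reactionDiffusion d g) f) =
      T (reactionDiffusion d g) (Pd (.u k K) f) +
      algebraMap ℝ _ (d k) * ∑ i, shift i (shift i (dU k f)) K +
      ∑ j, lc (fun J => Pd (.u k K) (XI J (g j))) (dU j f) := by
  rw [Pd_T, add_assoc]
  congr 1
  have h1 : ∀ j, lc (fun J => Pd (.u k K) (XI J (reactionDiffusion d g j))) (dU j f) =
      algebraMap ℝ _ (d j) * (if k = j then ∑ i, shift i (shift i (dU j f)) K else 0) +
        lc (fun J => Pd (.u k K) (XI J (g j))) (dU j f) := by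
    intro j
    rw [← lc_Pd_lap]
    simp only [reactionDiffusion, ← Algebra.smul_def, map_add, map_smul, Derivation.map_smul]
    induction dU j f using Finsupp.induction_linear with
    | zero => simp
    | add f g hf hg => simp only [map_add, smul_add, hf, hg]; ring
    | single J h => simp [Algebra.smul_def]; ring
  simp only [h1, Finset.sum_add_distrib]
  congr 1
  rw [Finset.sum_eq_single k] <;> simp +contextual [eq_comm]

/-! ### Leading terms of the determining equations -/

section TopOrder

variable {d : Fin m → ℝ} {g : Fin m → DiffFun n m} {r : ℕ} {f : DiffFun n m}

theorem reaction_term_of_gt (hg : ∀ j, OrdLt 1 (g j)) (hf : OrdLt (r + 1) f) (k : Fin m)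
    {K : Fin n → ℕ} (hK : r + 1 ≤ ∑ i, K i) :
    ∑ j, lc (fun J => Pd (.u k K) (XI J (g j))) (dU j f) = 0 := by
  refine Finset.sum_eq_zero fun j _ => ?_
  rw [lc_congr (a' := fun _ => 0)]
  · simp [Finsupp.linearCombination_apply]
  · intro J hJ
    refine (hg j).XI J k K ?_
    by_contra h
    exact hJ (hf j J (by omega))

/-- Only J with |J| ≤ r occur, and D^J g_j reaches order r only for |J| = r, where `Pd_XI_top`
leaves J = K. -/
theorem reaction_term_of_eq (hg : ∀ j, OrdLt 1 (g j)) (hf : OrdLt (r + 1) f) (k : Fin m)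
    {K : Fin n → ℕ} (hK : ∑ i, K i = r) :
    ∑ j, lc (fun J => Pd (.u k K) (XI J (g j))) (dU j f) =
      ∑ j, Pd (.u k 0) (g j) * Pd (.u j K) f := by
  refine Finset.sum_congr rfl fun j _ => ?_
  rw [lc_congr (a' := fun J => if J = K then Pd (.u k 0) (g j) else 0)]
  · rw [lc_ite_eq, dU_apply]
  · intro J hJ
    have : ∑ i, J i ≤ r := by
      by_contra h
      exact hJ (hf j J (by omega))
    rcases this.eq_or_lt with h | h
    · exact Pd_XI_top (hg j) k J K (by omega)
    · rw [(hg j).XI J k K (by omega), if_neg]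
      rintro rfl
      omega

/-- Multiplication of the symbol Σ h_J ξ^J by Σ ξ_i² is injective. The coefficient at J + 2·1_{i₀}
involves h_J and entries with larger exponent of ξ_{i₀}, which vanish by induction. -/
theorem eq_zero_of_sum_shift_shift (hn : 1 ≤ n) {h : Jet n m}
    (hh : ∀ K : Fin n → ℕ, ∑ i, K i = r + 2 → ∑ i, shift i (shift i h) K = 0)
    (J : Fin n → ℕ) (hJ : ∑ i, J i = r) : h J = 0 := by
  set i₀ : Fin n := ⟨0, hn⟩
  induction hN : r - J i₀ using Nat.strong_induction_on generalizing J with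
  | _ N ih =>
    have h1 := hh (J + Pi.single i₀ 1 + Pi.single i₀ 1) (by rw [sum_add_single, sum_add_single, hJ])
    rwa [Finset.sum_eq_single i₀, shift_apply_add, shift_apply_add] at h1
    · intro i _ hi
      rcases shift_eq_zero_or i (shift i h) (J + Pi.single i₀ 1 + Pi.single i₀ 1) with
        h2 | ⟨K', hK', h2⟩
      · exact h2
      rw [h2]
      rcases shift_eq_zero_or i h K' with h3 | ⟨K, rfl, h3⟩
      · exact h3
      rw [h3]
      have hs := congrArg (fun K : Fin n → ℕ => ∑ j, K j) hK'
      simp only [sum_add_single] at hs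
      have h0 := congrFun hK' i₀
      simp [hi.symm] at h0
      have hle : K i₀ ≤ ∑ j, K j := Finset.single_le_sum (fun _ _ => Nat.zero_le _)
        (Finset.mem_univ i₀)
      exact ih (r - K i₀) (by omega) K (by omega) rfl
    · simp

/-- At top order the hypothesis says that Σ_i ξ_i η_i annihilates the polynomial Σ (∂h_J/∂u^k_L) ξ^J
η^L with |J| = r, |L| = s. As before, the exponent of ξ_{i₀} orders the coefficients. -/
theorem ordLt_of_sum_X_shift (hn : 1 ≤ n) {h : Jet n m} {s : ℕ}
    (hh : ∀ K : Fin n → ℕ, ∑ i, K i = r + 1 → OrdLt (s + 1) (∑ i, X i (shift i h K)))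
    (hs : ∀ J : Fin n → ℕ, ∑ i, J i = r → OrdLt (s + 1) (h J))
    (J : Fin n → ℕ) (hJ : ∑ i, J i = r) : OrdLt s (h J) := by
  set i₀ : Fin n := ⟨0, hn⟩
  intro k L hL
  rcases hL.lt_or_eq with hL | hL
  · exact hs J hJ k L hL
  induction hN : r - J i₀ using Nat.strong_induction_on generalizing J L with
  | _ N ih =>
    -- The term i = i₀ gives ∂h_J/∂u_L; every other nonzero term belongs to an index whose i₀-entry
    -- is J_{i₀} + 1.
    have h1 := hh (J + Pi.single i₀ 1) (by rw [sum_add_single, hJ]) k (L + Pi.single i₀ 1)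
      (by rw [sum_add_single]; omega)
    rw [map_sum, Finset.sum_eq_single i₀, shift_apply_add, Pd_X_add, hs J hJ k _
      (by rw [sum_add_single]; omega), map_zero, zero_add] at h1
    · exact h1
    · intro i _ hi
      rcases shift_eq_zero_or i h (J + Pi.single i₀ 1) with h2 | ⟨K, hK, h2⟩
      · rw [h2, map_zero, map_zero]
      have hsum := congrArg (fun K : Fin n → ℕ => ∑ j, K j) hK
      simp only [sum_add_single] at hsum
      have h0 := congrFun hK i₀
      simp [hi.symm] at h0
      have hle : K i₀ ≤ ∑ j, K j := Finset.single_le_sum (fun _ _ => Nat.zero_le _)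
        (Finset.mem_univ i₀)
      have h3 := hs K (by omega) k (L + Pi.single i₀ 1) (by rw [sum_add_single]; omega)
      rw [h2]
      rcases eq_zero_or_exists_add_single (L + Pi.single i₀ 1) i with hLi | ⟨L', hL'⟩
      · rw [Pd_X_of_eq_zero k hLi, h3, map_zero]
      · rw [hL'] at h3 ⊢
        have hsum' := congrArg (fun K : Fin n → ℕ => ∑ j, K j) hL'
        simp only [sum_add_single] at hsum'
        rw [Pd_X_add, h3, map_zero, zero_add]
        exact ih (r - K i₀) (by omega) K (by omega) L' (by omega) (by omega) rfl
    · simp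

/-- The finite support provides a common bound for the orders of the coefficients, and
`ordLt_of_sum_X_shift` lowers it to zero. -/
theorem uIndep_of_sum_X_shift (hn : 1 ≤ n) {h : Jet n m}
    (hh : ∀ K : Fin n → ℕ, ∑ i, K i = r + 1 → OrdLt 1 (∑ i, X i (shift i h K)))
    (J : Fin n → ℕ) (hJ : ∑ i, J i = r) : UIndep (h J) := by
  have key : ∀ s, (∀ J : Fin n → ℕ, ∑ i, J i = r → OrdLt s (h J)) →
      ∀ J : Fin n → ℕ, ∑ i, J i = r → UIndep (h J) := by
    intro s
    induction s with
    | zero => exact fun hs J hJ => ordLt_zero_iff.1 (hs J hJ)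
    | succ s ih =>
      exact fun hs => ih (ordLt_of_sum_X_shift hn
        (fun K hK => (hh K hK).mono (Nat.le_add_left 1 s)) hs)
  choose ρ hρ using fun J => OrdLt.exists_of (h J)
  refine key (∑ J ∈ h.support, ρ J) (fun J _ => ?_) J hJ
  by_cases h0 : h J = 0
  · rw [h0]; exact OrdLt.zero
  · exact (hρ J).mono (Finset.single_le_sum (f := ρ) (fun _ _ => Nat.zero_le _)
      (Finsupp.mem_support_iff.2 h0))

variable {κ : ℝ} {R : DiffFun n m}

/-- In the derivative of the equation by u^k_K with |K| = r + 2 only the double shifts survive, with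
factor d_k from D_t and κ from the Laplacian. -/
theorem Pd_u_eq_zero_of_ne (hn : 1 ≤ n) (hg : ∀ j, OrdLt 1 (g j)) (hf : OrdLt (r + 1) f)
    (hR : OrdLt (r + 1) R)
    (heq : T (reactionDiffusion d g) f + algebraMap ℝ _ κ * lap f + R = 0)
    {k : Fin m} (hk : d k + κ ≠ 0) (J : Fin n → ℕ) (hJ : ∑ i, J i = r) :
    Pd (.u k J) f = 0 := by
  refine eq_zero_of_sum_shift_shift hn (h := dU k f) (fun K hK => ?_) J hJ
  have h1 := congrArg (Pd (.u k K)) heq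
  have h0 : Pd (.u k K) f = 0 := hf k K (by omega)
  have h2 : ∑ i, X i (shift i (dU k f) K) = 0 := by
    refine Finset.sum_eq_zero fun i _ => ?_
    rcases shift_eq_zero_or i (dU k f) K with h3 | ⟨K', rfl, h3⟩
    · rw [h3, map_zero]
    · rw [sum_add_single] at hK
      rw [h3, dU_apply, hf k K' (by omega), map_zero]
  rw [map_add, map_add, Pd_T_reactionDiffusion, reaction_term_of_gt hg hf k (by omega),
    hR k K (by omega), derivation_const_mul, Pd_lap, h0, h2] at h1
  simp only [map_zero, zero_add, mul_zero, add_zero] at h1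
  rw [← add_mul, ← map_add, ← Algebra.smul_def] at h1
  exact (smul_eq_zero.1 h1).resolve_left hk

/-- When d_k = -κ the double shifts cancel at every order, and for |K| = r + 1 only the cross terms
2κ Σ D_i of `Pd_lap` survive. -/
theorem uIndep_Pd_u_of_eq (hn : 1 ≤ n) (hg : ∀ j, OrdLt 1 (g j)) (hf : OrdLt (r + 1) f)
    (hR : OrdLt (r + 1) R)
    (heq : T (reactionDiffusion d g) f + algebraMap ℝ _ κ * lap f + R = 0)
    {k : Fin m} (hk : d k + κ = 0) (hκ : κ ≠ 0) (J : Fin n → ℕ) (hJ : ∑ i, J i = r) :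
    UIndep (Pd (.u k J) f) := by
  refine uIndep_of_sum_X_shift hn (h := dU k f) (fun K hK => ?_) J hJ
  have h1 := congrArg (Pd (.u k K)) heq
  have h0 : Pd (.u k K) f = 0 := hf k K (by omega)
  rw [map_add, map_add, Pd_T_reactionDiffusion, reaction_term_of_gt hg hf k (by omega),
    hR k K (by omega), derivation_const_mul, Pd_lap, h0, eq_neg_of_add_eq_zero_left hk] at h1
  simp only [map_zero, zero_add, add_zero, map_neg] at h1
  have h2 : (2 * κ) • ∑ i, X i (shift i (dU k f) K) = 0 := by
    rw [Algebra.smul_def, map_mul, map_ofNat]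
    linear_combination h1
  rw [(smul_eq_zero.1 h2).resolve_left (by simpa using hκ)]
  exact OrdLt.zero

theorem UIndep.lap {f : DiffFun n m} (hf : UIndep f) : UIndep (lap f) := by
  rw [lap_apply, ← ordLt_zero_iff]
  refine OrdLt.sum fun i _ => ?_
  rw [hf.X, (hf.Pd _).X, ordLt_zero_iff]
  exact (hf.Pd _).Pd _

/-- The terms of order zero in the top order part of the determining equations, differentiated
twice. -/
theorem Pd_Pd_top_eq_zero (hn : 1 ≤ n) (hg : ∀ j, OrdLt 1 (g j)) (hf : OrdLt (r + 1) f)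
    (hR : OrdLt (r + 1) R)
    (heq : T (reactionDiffusion d g) f + algebraMap ℝ _ κ * lap f + R = 0)
    {k : Fin m} (hk : d k + κ = 0) (hκ : κ ≠ 0)
    (hother : ∀ j, j ≠ k → ∀ J : Fin n → ℕ, ∑ i, J i = r → Pd (.u j J) f = 0)
    (hR' : 1 ≤ r → ∀ J : Fin n → ℕ, ∑ i, J i = r → OrdLt 1 (Pd (.u k J) R))
    (K : Fin n → ℕ) (hK : ∑ i, K i = r) (j l : Fin m) :
    Pd (.u j 0) (Pd (.u l 0) (Pd (.u k 0) (g k) * Pd (.u k K) f + Pd (.u k K) R)) = 0 := by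
  have hα := uIndep_Pd_u_of_eq hn hg hf hR heq hk hκ
  -- The derivative of the equation by u^k_K at order r; again d_k + κ = 0 removes the double
  -- shifts.
  have hmain : ∀ K : Fin n → ℕ, ∑ i, K i = r →
      T (reactionDiffusion d g) (Pd (.u k K) f) + algebraMap ℝ _ κ * lap (Pd (.u k K) f) +
      (2 * algebraMap ℝ _ κ) * ∑ i, X i (shift i (dU k f) K) +
      (Pd (.u k 0) (g k) * Pd (.u k K) f + Pd (.u k K) R) = 0 := by
    intro K hK
    have h1 := congrArg (Pd (.u k K)) heq
    have h2 : ∑ j, Pd (.u k 0) (g j) * Pd (.u j K) f = Pd (.u k 0) (g k) * Pd (.u k K) f :=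
      Finset.sum_eq_single k (fun j _ hj => by rw [hother j hj K hK, mul_zero]) (by simp)
    rw [map_add, map_add, Pd_T_reactionDiffusion, reaction_term_of_eq hg hf k hK, h2,
      derivation_const_mul, Pd_lap,
      eq_neg_of_add_eq_zero_left hk, map_zero, map_neg] at h1
    linear_combination h1
  have hA : ∀ K : Fin n → ℕ, ∑ i, K i = r →
      UIndep (T (reactionDiffusion d g) (Pd (.u k K) f) +
        algebraMap ℝ _ κ * lap (Pd (.u k K) f)) := by
    intro K hK
    rw [(hα K hK).T, ← ordLt_zero_iff]
    exact (ordLt_zero_iff.2 ((hα K hK).Pd _)).add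
      ((OrdLt.const κ).mul (ordLt_zero_iff.2 (hα K hK).lap))
  have hB : UIndep (∑ i, X i (shift i (dU k f) K)) := by
    rw [← ordLt_zero_iff]
    refine OrdLt.sum fun i _ => ?_
    rcases shift_eq_zero_or i (dU k f) K with h3 | ⟨K', rfl, h3⟩
    · rw [h3, map_zero]; exact OrdLt.zero
    rw [sum_add_single] at hK
    obtain ⟨s, rfl⟩ : ∃ s, r = s + 1 := ⟨r - 1, by omega⟩
    -- By `hmain` the divergence of the coefficients of order r - 1 has order zero in u, so the
    -- descent applies to them too.
    have hβ : UIndep (dU k f K') := by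
      refine uIndep_of_sum_X_shift (r := s) hn (fun L hL => ?_) K' (by omega)
      have h4 : (2 * κ) • ∑ i, X i (shift i (dU k f) L) =
          -((T (reactionDiffusion d g) (Pd (.u k L) f) + algebraMap ℝ _ κ * lap (Pd (.u k L) f)) +
            (Pd (.u k 0) (g k) * Pd (.u k L) f + Pd (.u k L) R)) := by
        rw [Algebra.smul_def, map_mul, map_ofNat]
        linear_combination hmain L hL
      have h5 : OrdLt 1 ((2 * κ) • ∑ i, X i (shift i (dU k f) L)) := by
        rw [h4]
        refine (((hA L hL).ordLt 1).add (OrdLt.add (OrdLt.mul ?_ ((hα L hL).ordLt 1))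
          (hR' (by omega) L hL))).neg
        intro j M hM
        rw [Pd_comm, hg k j M hM, map_zero]
      intro j M hM
      have h6 := h5 j M hM
      rw [Derivation.map_smul] at h6
      exact (smul_eq_zero.1 h6).resolve_left (by simpa using hκ)
    rw [h3, hβ.X, ordLt_zero_iff]
    exact hβ.Pd _
  -- All summands of `hmain` but the last depend on t and x only.
  have h7 := congrArg (fun y => Pd (.u j 0) (Pd (.u l 0) y)) (hmain K hK)
  have h8 : Pd (.u l 0) ((2 * algebraMap ℝ (DiffFun n m) κ) * ∑ i, X i (shift i (dU k f) K)) = 0 := by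
    rw [← map_ofNat (algebraMap ℝ (DiffFun n m)) 2, ← map_mul, ← Algebra.smul_def,
      Derivation.map_smul, hB.Pd_u, smul_zero]
  simp only [map_add _ (_ + _ : DiffFun n m) _, (hA K hK).Pd_u, h8, map_zero, zero_add] at h7
  simpa only [map_add] using h7

end TopOrder

/-! ### The Brusselator and its determining equations -/

/-- Constants as differential functions. -/
abbrev cst (r : ℝ) : DiffFun n m := algebraMap ℝ _ r

theorem cst_ofNat (N : ℕ) [N.AtLeastTwo] :
    (cst (OfNat.ofNat N) : DiffFun n m) = OfNat.ofNat N := map_ofNat _ N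

@[simp] theorem Pd_two (z : Coord n m) : Pd z (2 : DiffFun n m) = 0 := by
  rw [← cst_ofNat, Derivation.map_algebraMap]

variable (n) in
/-- The unknown `v`. -/
abbrev V : DiffFun n 2 := coord (.u 0 0)

variable (n) in
/-- The unknown `w`. -/
abbrev W : DiffFun n 2 := coord (.u 1 0)

variable (n) in
/-- The reaction terms of the Brusselator. -/
def reaction (a b : ℝ) : Fin 2 → DiffFun n 2 :=
  ![V n ^ 2 * W n - cst (b + 1) * V n + cst a, -(V n ^ 2 * W n) + cst b * V n]

variable (n) in
/-- The right-hand sides of the Brusselator as differential functions. -/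
abbrev rhsD (a b c : ℝ) : Fin 2 → DiffFun n 2 := reactionDiffusion ![1, c] (reaction n a b)

theorem lap_coord_apply (k : Fin m) (p : Coord n m → ℝ) :
    ((lap (coord (.u k 0)) : DiffFun n m) : Fun n m) p = ∑ i, p (.u k (Pi.single i 2)) := by
  rw [lap_apply, DiffFun.sum_apply]
  refine Finset.sum_congr rfl fun i _ => ?_
  rw [X_coord, X_coord, zero_add, ← Pi.single_add, coord_apply]

theorem coe_rhsD (a b c : ℝ) : (fun k => (rhsD n a b c k : Fun n 2)) = rhs n a b c := by
  funext k p
  fin_cases k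
  · simp [reactionDiffusion, reaction, rhs, lap_coord_apply]
    ring
  · simp [reactionDiffusion, reaction, rhs, lap_coord_apply]
    ring

theorem ordLt_reaction (a b : ℝ) (k : Fin 2) : OrdLt 1 (reaction n a b k) := by
  have hV : OrdLt 1 (V n) := OrdLt.coord_zero 0
  have hW : OrdLt 1 (W n) := OrdLt.coord_zero 1
  fin_cases k
  · exact (((hV.pow 2).mul hW).sub ((OrdLt.const _).mul hV)).add (OrdLt.const _)
  · exact ((hV.pow 2).mul hW).neg.add ((OrdLt.const _).mul hV)

@[simp] theorem Pd_V_V : Pd (.u 0 0) (V n) = 1 := by simp [Pd_coord]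
@[simp] theorem Pd_V_W : Pd (.u 0 0) (W n) = 0 := by simp [Pd_coord]
@[simp] theorem Pd_W_V : Pd (.u 1 0) (V n) = 0 := by simp [Pd_coord]
@[simp] theorem Pd_W_W : Pd (.u 1 0) (W n) = 1 := by simp [Pd_coord]

theorem Pd_V_reaction_zero (a b : ℝ) :
    Pd (.u 0 0) (reaction n a b 0) = 2 * V n * W n - cst (b + 1) := by
  simp [reaction, Derivation.leibniz, Derivation.leibniz_pow]; ring

theorem Pd_W_reaction_zero (a b : ℝ) : Pd (.u 1 0) (reaction n a b 0) = V n ^ 2 := by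
  simp [reaction, Derivation.leibniz, Derivation.leibniz_pow]

theorem Pd_V_reaction_one (a b : ℝ) :
    Pd (.u 0 0) (reaction n a b 1) = cst b - 2 * V n * W n := by
  simp [reaction, Derivation.leibniz, Derivation.leibniz_pow]; ring

theorem Pd_W_reaction_one (a b : ℝ) : Pd (.u 1 0) (reaction n a b 1) = -V n ^ 2 := by
  simp [reaction, Derivation.leibniz, Derivation.leibniz_pow]

theorem adj_smul_dU_of_ordLt_one {g : DiffFun n m} (hg : OrdLt 1 g) (k : Fin m)
    (h : DiffFun n m) : adj (h • dU k g) = Pd (.u k 0) g * h := by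
  have : dU k g = Finsupp.single 0 (Pd (.u k 0) g) := by
    ext1 K
    by_cases hK : K = 0
    · simp [hK]
    · rw [Finsupp.single_eq_of_ne hK, dU_apply, hg k K]
      by_contra h0
      refine hK (funext fun i => ?_)
      exact (Finset.sum_eq_zero_iff.1 (by omega : ∑ i, K i = 0)) i (Finset.mem_univ i)
  rw [this, Finsupp.smul_single, adj_single_zero, smul_eq_mul, mul_comm]

/-- The adjoint linearization: the Laplacian is formally self-adjoint, and the reaction terms
contribute the transposed Jacobian. -/
theorem adj_smul_dU_reactionDiffusion (d : Fin m → ℝ) {g : Fin m → DiffFun n m}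
    (hg : ∀ j, OrdLt 1 (g j)) (j k : Fin m) (h : DiffFun n m) :
    adj (h • dU k (reactionDiffusion d g j)) =
      (if k = j then cst (d k) * lap h else 0) + Pd (.u k 0) (g j) * h := by
  have h1 : adj (h • dU k (lap (coord (.u j 0)))) = if k = j then lap h else 0 := by
    rw [lap_apply, map_sum, Finset.smul_sum, map_sum]
    have : ∀ i, adj (h • dU k (X i (X i (coord (.u j 0))))) =
        if k = j then X i (X i h) else 0 := by
      intro i
      rw [adj_smul_dU_X, adj_smul_dU_X, dU_coord]
      split_ifs
      · simp [adj_single_zero]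
      · simp
    simp only [this, lap_apply]
    split_ifs <;> simp
  rw [reactionDiffusion, map_add, smul_add, map_add, adj_smul_dU_of_ordLt_one (hg j),
    ← Algebra.smul_def, Derivation.map_smul, smul_comm, map_smul, h1]
  congr 1
  split_ifs with hk
  · rw [hk, Algebra.smul_def]
  · simp

/-- The equations satisfied by the characteristics of conserved currents. -/
theorem determining_equations {a b c : ℝ} {J₀ : DiffFun n 2} {J : Fin n → DiffFun n 2}
    (hJ : T (rhsD n a b c) J₀ + ∑ i, X i (J i) = 0) :
    T (rhsD n a b c) (euler 0 J₀) + cst 1 * lap (euler 0 J₀) +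
      ((2 * V n * W n - cst (b + 1)) * euler 0 J₀ + (cst b - 2 * V n * W n) * euler 1 J₀) = 0 ∧
    T (rhsD n a b c) (euler 1 J₀) + cst c * lap (euler 1 J₀) +
      (V n ^ 2 * euler 0 J₀ + -V n ^ 2 * euler 1 J₀) = 0 := by
  have h : ∀ k, euler k (T (rhsD n a b c) J₀) = 0 := by
    intro k
    rw [eq_neg_of_add_eq_zero_left hJ, map_neg, map_sum]
    simp [euler_X]
  constructor
  · have h0 := h 0
    rw [euler_T, Fin.sum_univ_two, adj_smul_dU_reactionDiffusion _ (ordLt_reaction a b),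
      adj_smul_dU_reactionDiffusion _ (ordLt_reaction a b), Pd_V_reaction_zero,
      Pd_V_reaction_one] at h0
    simp only [if_true, zero_ne_one, if_false, Matrix.cons_val_zero] at h0
    linear_combination h0
  · have h1 := h 1
    rw [euler_T, Fin.sum_univ_two, adj_smul_dU_reactionDiffusion _ (ordLt_reaction a b),
      adj_smul_dU_reactionDiffusion _ (ordLt_reaction a b), Pd_W_reaction_zero,
      Pd_W_reaction_one] at h1
    simp only [if_true, one_ne_zero, if_false, Matrix.cons_val_one, Matrix.cons_val_zero] at h1
    linear_combination h1

theorem real_smul_eq_zero {r : ℝ} (hr : r ≠ 0) {f : DiffFun n m} (h : cst r * f = 0) : f = 0 := by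
  rw [← Algebra.smul_def] at h
  exact (smul_eq_zero.1 h).resolve_left hr

/-! ### Solution of the determining equations -/

section Determining

variable {a b c : ℝ} {p q : DiffFun n 2}

/-- The sums d_k + κ are 2 and c + 1 for p, 1 + c and 2c for q. Only c = -1 leaves ∂p/∂w_J and
∂q/∂v_J undecided; there ∂_v∂_w of the order r terms isolates a nonzero multiple of them. -/
theorem ordLt_succ_step (hn : 1 ≤ n) (hc : c ≠ 0) {r : ℕ}
    (h0 : T (rhsD n a b c) p + cst 1 * lap p +
      ((2 * V n * W n - cst (b + 1)) * p + (cst b - 2 * V n * W n) * q) = 0)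
    (h1 : T (rhsD n a b c) q + cst c * lap q + (V n ^ 2 * p + -V n ^ 2 * q) = 0)
    (hp : OrdLt (r + 1) p) (hq : OrdLt (r + 1) q) : OrdLt r p ∧ OrdLt r q := by
  have hg := ordLt_reaction (n := n) a b
  have hV : OrdLt (r + 1) (V n) := (OrdLt.coord_zero 0).mono (by omega)
  have hW : OrdLt (r + 1) (W n) := (OrdLt.coord_zero 1).mono (by omega)
  have h2 : OrdLt (r + 1) (2 : DiffFun n 2) := by
    have := OrdLt.const (n := n) (m := 2) (r := r + 1) 2
    rwa [map_ofNat] at this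
  have hR0 : OrdLt (r + 1)
      ((2 * V n * W n - cst (b + 1)) * p + (cst b - 2 * V n * W n) * q) :=
    ((((h2.mul hV).mul hW).sub (OrdLt.const _)).mul hp).add
      (((OrdLt.const _).sub ((h2.mul hV).mul hW)).mul hq)
  have hR1 : OrdLt (r + 1) (V n ^ 2 * p + -V n ^ 2 * q) :=
    ((hV.pow 2).mul hp).add ((hV.pow 2).neg.mul hq)
  have hpV : ∀ J : Fin n → ℕ, ∑ i, J i = r → Pd (.u 0 J) p = 0 :=
    Pd_u_eq_zero_of_ne hn hg hp hR0 h0 (by norm_num)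
  have hqW : ∀ J : Fin n → ℕ, ∑ i, J i = r → Pd (.u 1 J) q = 0 :=
    Pd_u_eq_zero_of_ne hn hg hq hR1 h1 (by simpa using hc)
  have hpos : 1 ≤ r → ∀ (k : Fin 2) (J : Fin n → ℕ), ∑ i, J i = r →
      Pd (.u k J) (V n) = 0 ∧ Pd (.u k J) (W n) = 0 := fun hr k J hJ =>
    ⟨OrdLt.coord_zero 0 k J (by omega), OrdLt.coord_zero 1 k J (by omega)⟩
  have hd0 : r = 0 → ∀ J : Fin n → ℕ, ∑ i, J i = r → J = 0 := by
    rintro rfl J hJ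
    exact funext fun i => Finset.sum_eq_zero_iff.1 hJ i (Finset.mem_univ i)
  have key : (∀ J : Fin n → ℕ, ∑ i, J i = r → Pd (.u 1 J) p = 0) ∧
      ∀ J : Fin n → ℕ, ∑ i, J i = r → Pd (.u 0 J) q = 0 := by
    by_cases hc1 : c = -1
    · subst hc1
      have hpW : ∀ J : Fin n → ℕ, ∑ i, J i = r → Pd (.u 1 J) p = 0 := by
        intro J hJ
        have hα := uIndep_Pd_u_of_eq hn hg hp hR0 h0 (k := 1) (by norm_num) one_ne_zero J hJ
        have hR : 1 ≤ r → ∀ J : Fin n → ℕ, ∑ i, J i = r →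
            Pd (.u 1 J) ((2 * V n * W n - cst (b + 1)) * p + (cst b - 2 * V n * W n) * q) =
              (2 * V n * W n - cst (b + 1)) * Pd (.u 1 J) p := by
          intro hr J hJ
          obtain ⟨e1, e2⟩ := hpos hr 1 J hJ
          simp [Derivation.leibniz, e1, e2, hqW J hJ]
        have h3 := Pd_Pd_top_eq_zero hn hg hp hR0 h0 (k := 1) (by norm_num) one_ne_zero
          (by
            intro j hj J hJ
            obtain rfl : j = 0 := by omega
            exact hpV J hJ)
          (by
            intro hr J hJ
            rw [hR hr J hJ]
            have h2 : OrdLt 1 (2 : DiffFun n 2) := by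
              have := OrdLt.const (n := n) (m := 2) (r := 1) 2
              rwa [map_ofNat] at this
            exact (((h2.mul (OrdLt.coord_zero 0)).mul (OrdLt.coord_zero 1)).sub
              (OrdLt.const _)).mul ((uIndep_Pd_u_of_eq hn hg hp hR0 h0 (k := 1) (by norm_num)
                one_ne_zero J hJ).ordLt 1))
          J hJ 0 1
        rw [Pd_W_reaction_one] at h3
        rcases Nat.eq_zero_or_pos r with hr | hr
        · obtain rfl := hd0 hr J hJ
          have e1 := hα.Pd_u 0 0
          have e2 := hα.Pd_u 1 0
          have e3 := hqW 0 hJ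
          simp [Derivation.leibniz, Derivation.leibniz_pow, e1, e2, e3] at h3
          -- For r = 0 the term 2vwp is differentiated twice by w and once by v, which gives 4
          -- ∂p/∂w. For r > 0 its coefficient is differentiated only by v and w, which gives 2.
          refine real_smul_eq_zero (r := 4) (by norm_num) ?_
          rw [cst_ofNat]
          linear_combination h3
        · rw [hR hr J hJ] at h3
          have e1 := hα.Pd_u 0 0
          have e2 := hα.Pd_u 1 0
          simp [Derivation.leibniz, Derivation.leibniz_pow, e1, e2] at h3
          refine real_smul_eq_zero (r := 2) (by norm_num) ?_
          rw [cst_ofNat]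
          linear_combination h3
      -- The case r = 0 for q needs ∂p/∂w = 0, because ∂(v²p)/∂v contains 2vp.
      refine ⟨hpW, fun J hJ => ?_⟩
      have hα := uIndep_Pd_u_of_eq hn hg hq hR1 h1 (k := 0) (by norm_num) hc J hJ
      have hR : 1 ≤ r → ∀ J : Fin n → ℕ, ∑ i, J i = r →
          Pd (.u 0 J) (V n ^ 2 * p + -V n ^ 2 * q) = -V n ^ 2 * Pd (.u 0 J) q := by
        intro hr J hJ
        obtain ⟨e1, e2⟩ := hpos hr 0 J hJ
        simp [Derivation.leibniz, Derivation.leibniz_pow, e1, hpV J hJ]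
      have h3 := Pd_Pd_top_eq_zero hn hg hq hR1 h1 (k := 0) (by norm_num) hc
        (by
          intro j hj J hJ
          obtain rfl : j = 1 := by omega
          exact hqW J hJ)
        (by
          intro hr J hJ
          rw [hR hr J hJ]
          exact ((OrdLt.coord_zero 0).pow 2).neg.mul ((uIndep_Pd_u_of_eq hn hg hq hR1 h1 (k := 0)
            (by norm_num) hc J hJ).ordLt 1))
        J hJ 0 1
      rw [Pd_V_reaction_zero] at h3
      rcases Nat.eq_zero_or_pos r with hr | hr
      · obtain rfl := hd0 hr J hJ
        have e1 := hα.Pd_u 0 0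
        have e2 := hα.Pd_u 1 0
        have e3 := hqW 0 hJ
        have e4 := hpV 0 hJ
        have e5 := hpW 0 hJ
        simp [Derivation.leibniz, Derivation.leibniz_pow, e1, e2, e3, e4, e5] at h3
        refine real_smul_eq_zero (r := 2) (by norm_num) ?_
        rw [cst_ofNat]
        linear_combination h3
      · rw [hR hr J hJ] at h3
        have e1 := hα.Pd_u 0 0
        have e2 := hα.Pd_u 1 0
        simp [Derivation.leibniz, Derivation.leibniz_pow, e1, e2] at h3
        refine real_smul_eq_zero (r := 2) (by norm_num) ?_
        rw [cst_ofNat]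
        linear_combination h3
    · have hc2 : 1 + c ≠ 0 := fun h => hc1 (by linarith)
      exact ⟨Pd_u_eq_zero_of_ne hn hg hp hR0 h0 (by simpa [add_comm] using hc2),
        Pd_u_eq_zero_of_ne hn hg hq hR1 h1 (by simpa using hc2)⟩
  constructor
  · intro k K hK
    rcases hK.lt_or_eq with h | h
    · exact hp k K h
    · fin_cases k
      · exact hpV K h.symm
      · exact key.1 K h.symm
  · intro k K hK
    rcases hK.lt_or_eq with h | h
    · exact hq k K h
    · fin_cases k
      · exact key.2 K h.symm
      · exact hqW K h.symm

/-- The solutions of the determining equations. -/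
theorem solve_determining (hn : 1 ≤ n) (hc : c ≠ 0)
    (h0 : T (rhsD n a b c) p + cst 1 * lap p +
      ((2 * V n * W n - cst (b + 1)) * p + (cst b - 2 * V n * W n) * q) = 0)
    (h1 : T (rhsD n a b c) q + cst c * lap q + (V n ^ 2 * p + -V n ^ 2 * q) = 0) :
    UIndep p ∧ q = p ∧ Pd .t p + lap p - p = 0 ∧ Pd .t p + cst c * lap p = 0 := by
  have hdown : ∀ r, OrdLt r p → OrdLt r q → UIndep p ∧ UIndep q := by
    intro r
    induction r with
    | zero => exact fun hp hq => ⟨ordLt_zero_iff.1 hp, ordLt_zero_iff.1 hq⟩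
    | succ r ih =>
      intro hp hq
      obtain ⟨hp, hq⟩ := ordLt_succ_step hn hc h0 h1 hp hq
      exact ih hp hq
  obtain ⟨r, hr⟩ := OrdLt.exists_of p
  obtain ⟨s, hs⟩ := OrdLt.exists_of q
  obtain ⟨hp, hq⟩ := hdown (max r s) (hr.mono (le_max_left _ _)) (hs.mono (le_max_right _ _))
  have hqp : q = p := by
    -- With p, q functions of t and x, the coefficient of vw in the first equation is 2(p - q).
    have h2 := congrArg (fun f => Pd (.u 0 0) (Pd (.u 1 0) f)) h0
    simp [Derivation.leibniz, hp.T, hp.Pd_u, hq.Pd_u, (hp.Pd .t).Pd_u, hp.lap.Pd_u] at h2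
    refine (sub_eq_zero.1 (real_smul_eq_zero (r := 2) (by norm_num) ?_)).symm
    rw [cst_ofNat]
    linear_combination h2
  subst hqp
  rw [hp.T] at h0 h1
  refine ⟨hp, rfl, ?_, ?_⟩
  · simp only [cst, map_add, map_one] at h0
    linear_combination h0
  · linear_combination h1

end Determining

/-! ### Translation to currents of plain functions -/

theorem coe_D_zero (F : Fin m → DiffFun n m) (f : DiffFun n m) :
    D (fun k => (F k : Fun n m)) 0 f = (T F f : Fun n m) := (coe_T F f).symm

theorem coe_D_succ (F : Fin m → DiffFun n m) (i : Fin n) (f : DiffFun n m) :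
    D (fun k => (F k : Fun n m)) i.succ f = (X i f : Fun n m) := (coe_X i f).symm

theorem isConservedCurrent_iff (F : Fin m → DiffFun n m) (J : Fin (n + 1) → DiffFun n m) :
    IsConservedCurrent (fun k => (F k : Fun n m)) (fun k => (J k : Fun n m)) ↔
      T F (J 0) + ∑ i : Fin n, X i (J i.succ) = 0 := by
  have h : ∀ p, ∑ k, D (fun k => (F k : Fun n m)) k (J k) p =
      ((T F (J 0) + ∑ i : Fin n, X i (J i.succ) : DiffFun n m) : Fun n m) p := by
    intro p
    rw [Fin.sum_univ_succ, coe_D_zero, DiffFun.add_apply, DiffFun.sum_apply]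
    simp only [coe_D_succ]
  constructor
  · rintro ⟨_, h1⟩
    exact DiffFun.ext fun p => by rw [← h, h1]; rfl
  · intro h1
    exact ⟨fun k => (J k).2, fun p => by rw [h, h1]; rfl⟩

theorem mon_neg_Xl (I : Fin n → ℕ) (f : DiffFun n m) :
    mon (fun i => -Xl i) I f = (-1 : ℝ) ^ (∑ i, I i) • XI I f := by
  induction I using multiIndex_induction with
  | h0 => simp
  | hs I i ih =>
    rw [mon_add_single negXl_commute, XI_add_single, sum_add_single, Module.End.mul_apply, ih]
    simp [pow_succ]

theorem characteristic_eq_euler (J : Fin (n + 1) → DiffFun n m) (k : Fin m)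
    (p : Coord n m → ℝ) :
    characteristic (fun l => (J l : Fun n m)) k p = (euler k (J 0) : Fun n m) p := by
  have h : ∀ I : Fin n → ℕ, (-1 : ℝ) ^ (∑ i, I i) * DxI I (pd (.u k I) (J 0)) p =
      (mon (fun i => -Xl i) I (dU k (J 0) I) : Fun n m) p := by
    intro I
    rw [mon_neg_Xl, DiffFun.smul_apply, coe_XI, dU_apply, coe_Pd]
  rw [characteristic, finsum_congr h,
    finsum_eq_sum_of_support_subset (s := (dU k (J 0)).support), euler_apply, adj, assemble,
    Finsupp.lsum_apply, Finsupp.sum, DiffFun.sum_apply]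
  · rfl
  · intro I hI
    rw [Finset.mem_coe, Finsupp.mem_support_iff]
    intro h0
    exact hI (by simp [h0])

theorem sum_Iio_eq {M : Type} [AddCommMonoid M] {N : ℕ} (k : Fin N) (g : Fin N → M) :
    ∑ l ∈ Finset.Iio k, g l = ∑ l, if l < k then g l else 0 := by
  rw [← Finset.sum_filter]
  congr 1
  ext
  simp

theorem sum_Ioi_eq {M : Type} [AddCommMonoid M] {N : ℕ} (k : Fin N) (g : Fin N → M) :
    ∑ l ∈ Finset.Ioi k, g l = ∑ l, if k < l then g l else 0 := by
  rw [← Finset.sum_filter]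
  congr 1
  ext
  simp

theorem isTrivialCurrent_of_euler (F : Fin m → DiffFun n m) (hn : 1 ≤ n)
    (J : Fin (n + 1) → DiffFun n m)
    (hJ : IsConservedCurrent (fun k => (F k : Fun n m)) (fun k => (J k : Fun n m)))
    (he : ∀ k, euler k (J 0) = 0) :
    IsTrivialCurrent (fun k => (F k : Fun n m)) (fun k => (J k : Fun n m)) := by
  obtain ⟨P, L, h0, h1⟩ := exists_potential F hn (J 0) (fun i => J i.succ)
    ((isConservedCurrent_iff F J).1 hJ) he
  -- The `P i` are the potentials with time index 0 and the `L i j` the spatial ones; only entries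
  -- above the diagonal matter.
  set M : Fin (n + 1) → Fin (n + 1) → DiffFun n m := fun k l =>
    Fin.cases (Fin.cases 0 P l) (fun i => Fin.cases 0 (L i) l) k
  have key : ∀ k p, (J k : Fun n m) p =
      ∑ l ∈ Finset.Iio k, D (fun k => (F k : Fun n m)) l (M l k : Fun n m) p -
        ∑ l ∈ Finset.Ioi k, D (fun k => (F k : Fun n m)) l (M k l : Fun n m) p := by
    intro k p
    rw [sum_Iio_eq, sum_Ioi_eq, Fin.sum_univ_succ, Fin.sum_univ_succ]
    refine Fin.cases ?_ (fun i => ?_) k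
    · rw [h0]
      simp only [coe_D_succ, DiffFun.neg_apply, DiffFun.sum_apply]
      simp [M]
    · rw [h1 i]
      simp only [coe_D_succ, coe_D_zero, DiffFun.add_apply, DiffFun.sub_apply,
        DiffFun.sum_apply]
      simp only [sum_Iio_eq, sum_Ioi_eq, Fin.succ_lt_succ_iff]
      simp [M]
      ring
  exact ⟨fun k l => (M k l : Fun n m), fun k l _ => (M k l).2, key⟩

/-! ### Profiles and exponentials as differential functions -/

/-- The point with time `s`, space variables `x` and vanishing `u^k_I`. -/
def point (s : ℝ) (x : Fin n → ℝ) : Coord n m → ℝ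
  | .t => s
  | .x i => x i
  | .u _ _ => 0

theorem point_update_t (s r : ℝ) (x : Fin n → ℝ) :
    Function.update (point s x : Coord n m → ℝ) .t r = point r x := by
  funext z
  cases z <;> simp [point]

theorem point_update_x (s r : ℝ) (x : Fin n → ℝ) (i : Fin n) :
    Function.update (point s x : Coord n m → ℝ) (.x i) r = point s (Function.update x i r) := by
  funext z
  rcases z with _ | j | _
  · simp [point]
  · by_cases h : j = i
    · subst h; simp [point]
    · simp [point, h]
  · simp [point]

theorem UIndep.apply_eq {f : DiffFun n m} (hf : UIndep f) (p : Coord n m → ℝ) :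
    (f : Fun n m) p = (f : Fun n m) (point (p .t) (space p)) := by
  have h : f - atZero isU f = 0 := by
    rw [sub_atZero_isU]
    exact Finset.sum_eq_zero fun k _ => by rw [hf k, map_zero, map_zero]
  conv_lhs => rw [sub_eq_zero.1 h]
  change (f : Fun n m) (scale isU 0 p) = _
  refine congrArg (f : Fun n m) (funext fun z => ?_)
  cases z <;> simp [point, scale, isU, space]

theorem contDiff_comp_point (f : DiffFun n m) (s : ℝ) :
    ContDiff ℝ ∞ fun x => (f : Fun n m) (point s x) := by
  obtain ⟨S, g, hg, h⟩ := f.isDiffFun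
  simp only [h]
  refine hg.comp (contDiff_pi.2 ?_)
  rintro ⟨_ | _ | _, _⟩
  · exact contDiff_const
  · exact contDiff_apply ℝ ℝ _
  · exact contDiff_const

theorem pd_comp_point (f : DiffFun n m) (s : ℝ) (i : Fin n) (x : Fin n → ℝ) :
    pd i (fun x => (f : Fun n m) (point s x)) x = (Pd (.x i) f : Fun n m) (point s x) := by
  rw [coe_Pd, pd, pd]
  simp only [point_update_x]
  rfl

/-- A smooth function of the space variables as a differential function. -/
def ofSpace (G : (Fin n → ℝ) → ℝ) (hG : ContDiff ℝ ∞ G) : DiffFun n m :=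
  ⟨fun p => G (space p), Finset.univ.image .x,
    fun q => G fun i => q ⟨.x i, Finset.mem_image_of_mem _ (Finset.mem_univ i)⟩,
    hG.comp (by fun_prop), fun _ => rfl⟩

theorem ofSpace_apply (G : (Fin n → ℝ) → ℝ) (hG : ContDiff ℝ ∞ G) (p : Coord n m → ℝ) :
    ((ofSpace G hG : DiffFun n m) : Fun n m) p = G (space p) := rfl

theorem space_update_x (p : Coord n m → ℝ) (i : Fin n) (r : ℝ) :
    space (Function.update p (.x i) r) = Function.update (space p) i r := by
  funext j
  by_cases h : j = i
  · subst h; simp [space]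
  · simp [space, h]

theorem space_update_of_ne (p : Coord n m → ℝ) {z : Coord n m} (hz : ∀ i, z ≠ .x i) (r : ℝ) :
    space (Function.update p z r) = space p := by
  funext j
  simp [space, (hz j).symm]

theorem Pd_ofSpace_of_ne (G : (Fin n → ℝ) → ℝ) (hG : ContDiff ℝ ∞ G) {z : Coord n m}
    (hz : ∀ i, z ≠ .x i) : Pd z (ofSpace G hG) = 0 := by
  refine DiffFun.ext fun p => ?_
  rw [coe_Pd, pd]
  simp [ofSpace_apply, space_update_of_ne p hz]

theorem Pd_ofSpace_x (G : (Fin n → ℝ) → ℝ) (hG : ContDiff ℝ ∞ G) (i : Fin n)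
    (p : Coord n m → ℝ) :
    ((Pd (.x i) (ofSpace G hG : DiffFun n m) : DiffFun n m) : Fun n m) p = pd i G (space p) := by
  rw [coe_Pd, pd, pd]
  simp only [ofSpace_apply, space_update_x]
  rfl

theorem uIndep_ofSpace (G : (Fin n → ℝ) → ℝ) (hG : ContDiff ℝ ∞ G) :
    UIndep (ofSpace G hG : DiffFun n m) :=
  fun _ => Finsupp.ext fun _ => Pd_ofSpace_of_ne G hG (by simp)

theorem contDiff_pd {G : (Fin n → ℝ) → ℝ} (hG : ContDiff ℝ ∞ G) (i : Fin n) :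
    ContDiff ℝ ∞ (pd i G) := by
  -- Without unknowns (m = 0) the calculus of differential functions gives smoothness in x directly.
  have := contDiff_comp_point (Pd (.x i) (ofSpace G hG : DiffFun n 0)) 0
  simp only [Pd_ofSpace_x] at this
  exact this

theorem exists_isAntiderivatives {G : (Fin n → ℝ) → ℝ} (hG : ContDiff ℝ ∞ G) :
    ∃ H : Fin n → (Fin n → ℝ) → ℝ, IsAntiderivatives G H := by
  refine ⟨fun i x => (antideriv (.x i) (ofSpace G hG : DiffFun n 0) : Fun n 0) (point 0 x),
    fun i => ⟨contDiff_comp_point _ 0, fun x => ?_⟩⟩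
  rw [pd_comp_point, Pd_antideriv_self]
  rfl

variable (n m) in
/-- The function `e^{r t}`. -/
def expT (r : ℝ) : DiffFun n m :=
  ⟨fun p => Real.exp (r * p .t), {.t}, fun q => Real.exp (r * q ⟨.t, by simp⟩), by fun_prop,
    fun _ => rfl⟩

theorem expT_apply (r : ℝ) (p : Coord n m → ℝ) :
    (expT n m r : Fun n m) p = Real.exp (r * p .t) := rfl

theorem Pd_t_expT (r : ℝ) : Pd .t (expT n m r) = cst r * expT n m r := by
  refine DiffFun.ext fun p => ?_
  rw [coe_Pd, pd]
  simp only [expT_apply, Function.update_self]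
  have : HasDerivAt (fun s => Real.exp (r * s)) (Real.exp (r * p .t) * (r * 1)) (p .t) :=
    ((hasDerivAt_id' _).const_mul r).exp
  rw [this.deriv, DiffFun.mul_apply, expT_apply, DiffFun.algebraMap_apply]
  ring

theorem Pd_expT_of_ne (r : ℝ) {z : Coord n m} (hz : z ≠ .t) : Pd z (expT n m r) = 0 := by
  refine DiffFun.ext fun p => ?_
  rw [coe_Pd, pd]
  simp [expT_apply, hz.symm]

theorem uIndep_expT (r : ℝ) : UIndep (expT n m r) :=
  fun _ => Finsupp.ext fun _ => Pd_expT_of_ne r (by simp)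

/-- Solutions of `∂f/∂t = r f` that depend on the independent variables only. -/
theorem eq_mul_exp_of_Pd_t {f : DiffFun n m} (hf : UIndep f) {r : ℝ} (h : Pd .t f = cst r * f)
    (p : Coord n m → ℝ) :
    (f : Fun n m) p = (f : Fun n m) (point 0 (space p)) * Real.exp (r * p .t) := by
  have h1 : ∀ s, HasDerivAt (fun s => (f : Fun n m) (point s (space p)) * Real.exp (-r * s)) 0 s := by
    intro s
    have h2 := hasDerivAt_update f.2 .t (point 0 (space p)) s
    simp only [point_update_t] at h2
    have h3 : pd .t (f : Fun n m) (point s (space p)) = r * (f : Fun n m) (point s (space p)) := by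
      rw [← coe_Pd, h]; rfl
    have h4 : HasDerivAt (fun s => Real.exp (-r * s)) (Real.exp (-r * s) * (-r * 1)) s :=
      ((hasDerivAt_id' _).const_mul (-r)).exp
    refine (h2.mul h4).congr_deriv ?_
    change pd .t (f : Fun n m) (point s (space p)) * _ + _ = _
    rw [h3]
    ring
  have h5 := is_const_of_deriv_eq_zero (fun s => (h1 s).differentiableAt) (fun s => (h1 s).deriv)
    (p .t) 0
  simp only [mul_zero, Real.exp_zero, mul_one] at h5
  rw [hf.apply_eq p, ← h5, mul_assoc, ← Real.exp_add]
  simp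

theorem UIndep.lap_apply {f : DiffFun n m} (hf : UIndep f) :
    Brusselator.lap f = ∑ i, Brusselator.Pd (.x i) (Brusselator.Pd (.x i) f) := by
  rw [Brusselator.lap_apply]
  exact Finset.sum_congr rfl fun i _ => by rw [hf.X, (hf.Pd _).X]

theorem euler_of_ordLt_one {f : DiffFun n m} (hf : OrdLt 1 f) (k : Fin m) :
    euler k f = Pd (.u k 0) f := by
  have := adj_smul_dU_of_ordLt_one hf k 1
  rwa [one_smul, mul_one] at this

/-! ### The explicit conserved currents -/

/-- The currents of the theorem as differential functions. -/
def currentD (a c : ℝ) (G : (Fin n → ℝ) → ℝ) (H : Fin n → (Fin n → ℝ) → ℝ)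
    (hG : ContDiff ℝ ∞ G) (hH : IsAntiderivatives G H) : Fin (n + 1) → DiffFun n 2 :=
  Fin.cases (ofSpace G hG * expT n 2 (c / (c - 1)) * (V n + W n)) fun i =>
    expT n 2 (c / (c - 1)) * (Pd (.x i) (ofSpace G hG) * (V n + cst c * W n) -
      ofSpace G hG * (X i (V n) + cst c * X i (W n)) - cst (a / n) * ofSpace (H i) (hH i).1)

theorem coe_currentD (a c : ℝ) (G : (Fin n → ℝ) → ℝ) (H : Fin n → (Fin n → ℝ) → ℝ)
    (hG : ContDiff ℝ ∞ G) (hH : IsAntiderivatives G H) :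
    (fun k => (currentD a c G H hG hH k : Fun n 2)) = current a c G H := by
  funext k p
  refine Fin.cases ?_ (fun i => ?_) k
  · simp [currentD, current, ofSpace_apply, expT_apply, div_mul_eq_mul_div]
  · simp [currentD, current, ofSpace_apply, expT_apply, div_mul_eq_mul_div, Pd_ofSpace_x, X_coord]

theorem T_coord (F : Fin m → DiffFun n m) (k : Fin m) : T F (coord (.u k 0)) = F k := by
  rw [T_apply, Pd_coord, if_neg (by simp), zero_add, evol_coord, XI_zero]

/-- The cubic terms cancel in v + w, leaving D_t(v + w) = Δ(v + cw) - v + a. Green's identity for g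
and v + cw removes the Laplacians of v and w, the n antiderivatives remove a, and the rest is a
multiple of G + (c-1)ΔG. -/
theorem conserved_currentD (hn : 1 ≤ n) (a b : ℝ) {c : ℝ} (hc : c ≠ 1) {G : (Fin n → ℝ) → ℝ}
    {H : Fin n → (Fin n → ℝ) → ℝ} (hG : IsProfile c G) (hH : IsAntiderivatives G H) :
    T (rhsD n a b c) (currentD a c G H hG.1 hH 0) +
      ∑ i : Fin n, X i (currentD a c G H hG.1 hH i.succ) = 0 := by
  have hc' : c - 1 ≠ 0 := sub_ne_zero.2 hc
  have hn' : (n : ℝ) ≠ 0 := by positivity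
  set g : DiffFun n 2 := ofSpace G hG.1
  set E : DiffFun n 2 := expT n 2 (c / (c - 1))
  have hg : UIndep g := uIndep_ofSpace G hG.1
  have hE : UIndep E := uIndep_expT _
  have hlap : g + cst (c - 1) * lap g = 0 := by
    refine DiffFun.ext fun p => ?_
    have h1 := hG.2 (space p)
    have h2 : ∀ i, (Pd (.x i) (Pd (.x i) g) : Fun n 2) p = pd i (pd i G) (space p) := by
      intro i
      have : Pd (.x i) g = ofSpace (pd i G) (contDiff_pd hG.1 i) :=
        DiffFun.ext fun p => Pd_ofSpace_x G hG.1 i p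
      rw [this, Pd_ofSpace_x]
    rw [hg.lap_apply, DiffFun.add_apply, DiffFun.mul_apply, DiffFun.sum_apply,
      DiffFun.algebraMap_apply]
    simp only [h2]
    exact h1
  have hTg : T (rhsD n a b c) g = 0 := by rw [hg.T]; exact Pd_ofSpace_of_ne G hG.1 (by simp)
  have hTE : T (rhsD n a b c) E = cst (c / (c - 1)) * E := by rw [hE.T]; exact Pd_t_expT _
  have hXE : ∀ i, X i E = 0 := fun i => by rw [hE.X]; exact Pd_expT_of_ne _ (by simp)
  have hTV : T (rhsD n a b c) (V n) = lap (V n) + (V n ^ 2 * W n - cst (b + 1) * V n + cst a) := by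
    rw [T_coord]; simp [reactionDiffusion, reaction]
  have hTW : T (rhsD n a b c) (W n) = cst c * lap (W n) + (-(V n ^ 2 * W n) + cst b * V n) := by
    rw [T_coord]; simp [reactionDiffusion, reaction]
  have hT0 : T (rhsD n a b c) (currentD a c G H hG.1 hH 0) =
      g * E * (cst (c / (c - 1)) * (V n + W n) + lap (V n) + cst c * lap (W n) - V n + cst a) := by
    change T (rhsD n a b c) (g * E * (V n + W n)) = _
    rw [Derivation.leibniz, Derivation.leibniz, hTg, hTE, map_add, hTV, hTW]
    simp only [smul_eq_mul, cst, map_add, map_one]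
    ring
  have hXi : ∀ i : Fin n, X i (currentD a c G H hG.1 hH i.succ) =
      E * (X i (X i g) * (V n + cst c * W n) - g * (X i (X i (V n)) + cst c * X i (X i (W n))) -
        cst (a / n) * g) := by
    intro i
    have hXH : X i (ofSpace (H i) (hH i).1 : DiffFun n 2) = g := by
      rw [(uIndep_ofSpace (H i) (hH i).1).X]
      exact DiffFun.ext fun p => (Pd_ofSpace_x _ _ _ _).trans ((hH i).2 _)
    change X i (E * (Pd (.x i) g * (V n + cst c * W n) -
      g * (X i (V n) + cst c * X i (W n)) - cst (a / n) * ofSpace (H i) (hH i).1)) = _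
    rw [← hg.X, Derivation.leibniz, hXE]
    simp only [map_sub, map_add, Derivation.leibniz (X i) (X i g), Derivation.leibniz (X i) g,
      derivation_const_mul, hXH, smul_eq_mul]
    ring
  have hsum : ∑ i : Fin n, X i (currentD a c G H hG.1 hH i.succ) =
      E * (lap g * (V n + cst c * W n) - g * (lap (V n) + cst c * lap (W n)) - cst a * g) := by
    have h1 : (n : DiffFun n 2) * cst (a / n) = cst a := by
      rw [← map_natCast (algebraMap ℝ (DiffFun n 2)) n, ← map_mul, mul_div_cancel₀ a hn']
    simp only [hXi]
    rw [← Finset.mul_sum, Finset.sum_sub_distrib, Finset.sum_sub_distrib, ← Finset.sum_mul,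
      ← Finset.mul_sum, Finset.sum_add_distrib, ← Finset.mul_sum, Finset.sum_const,
      Finset.card_univ, Fintype.card_fin, nsmul_eq_mul, ← mul_assoc, h1, ← lap_apply,
      ← lap_apply, ← lap_apply]
  rw [hT0, hsum]
  -- Multiplication by c - 1 clears the denominator in the exponential rate; the remainder is then
  -- E(v + cw)(g + (c-1)Δg).
  refine real_smul_eq_zero hc' ?_
  have h2 : cst (c - 1) * cst (c / (c - 1)) = (cst c : DiffFun n 2) := by
    rw [← map_mul, mul_div_cancel₀ c hc']
  have h3 : (cst (c - 1) : DiffFun n 2) = cst c - 1 := by simp [cst]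
  linear_combination (E * (V n + cst c * W n)) * hlap + (g * E * (V n + W n)) * h2 -
    (g * E * V n) * h3

theorem euler_currentD (a : ℝ) {c : ℝ} {G : (Fin n → ℝ) → ℝ}
    {H : Fin n → (Fin n → ℝ) → ℝ} (hG : ContDiff ℝ ∞ G) (hH : IsAntiderivatives G H) (k : Fin 2) :
    euler k (currentD a c G H hG hH 0) = ofSpace G hG * expT n 2 (c / (c - 1)) := by
  change euler k (ofSpace G hG * expT n 2 (c / (c - 1)) * (V n + W n)) = _
  have hg := uIndep_ofSpace (m := 2) G hG
  have hE := uIndep_expT (n := n) (m := 2) (c / (c - 1))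
  rw [euler_of_ordLt_one (((hg.ordLt 1).mul (hE.ordLt 1)).mul
    ((OrdLt.coord_zero 0).add (OrdLt.coord_zero 1))), Derivation.leibniz, Derivation.leibniz,
    hg.Pd_u, hE.Pd_u]
  fin_cases k <;> simp

/-! ### Characteristics of arbitrary conserved currents -/

/-- The Euler derivatives of conserved densities. -/
theorem euler_of_conserved (hn : 1 ≤ n) {a b c : ℝ} (hc : c ≠ 0) {J : Fin (n + 1) → DiffFun n 2}
    (hJ : T (rhsD n a b c) (J 0) + ∑ i : Fin n, X i (J i.succ) = 0) :
    (∀ k, euler k (J 0) = euler 0 (J 0)) ∧ UIndep (euler 0 (J 0)) ∧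
      euler 0 (J 0) + cst (c - 1) * lap (euler 0 (J 0)) = 0 ∧
      cst (c - 1) * Pd .t (euler 0 (J 0)) = cst c * euler 0 (J 0) := by
  obtain ⟨h0, h1⟩ := determining_equations hJ
  obtain ⟨hu, hq, e1, e2⟩ := solve_determining hn hc h0 h1
  have h3 : (cst (c - 1) : DiffFun n 2) = cst c - 1 := by simp [cst]
  refine ⟨fun k => ?_, hu, ?_, ?_⟩
  · fin_cases k
    · rfl
    · exact hq
  · rw [h3]
    linear_combination e2 - e1
  · rw [h3]
    linear_combination cst c * e1 - e2

theorem exists_profile (hn : 1 ≤ n) {a b c : ℝ} (hc : c ≠ 0) (hc1 : c ≠ 1)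
    {J : Fin (n + 1) → DiffFun n 2}
    (hJ : T (rhsD n a b c) (J 0) + ∑ i : Fin n, X i (J i.succ) = 0) :
    ∃ G : (Fin n → ℝ) → ℝ, ∃ hG : IsProfile c G,
      ∀ k, euler k (J 0) = ofSpace G hG.1 * expT n 2 (c / (c - 1)) := by
  obtain ⟨hk, hu, h1, h2⟩ := euler_of_conserved hn hc hJ
  have hc' : c - 1 ≠ 0 := sub_ne_zero.2 hc1
  set f := euler 0 (J 0)
  have ht : Pd .t f = cst (c / (c - 1)) * f := by
    refine sub_eq_zero.1 (real_smul_eq_zero hc' ?_)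
    have h3 : cst (c - 1) * cst (c / (c - 1)) = (cst c : DiffFun n 2) := by
      rw [← map_mul, mul_div_cancel₀ c hc']
    linear_combination h2 - f * h3
  refine ⟨fun x => (f : Fun n 2) (point 0 x), ⟨contDiff_comp_point f 0, fun x => ?_⟩, fun k => ?_⟩
  · have h3 : ∀ i, pd i (pd i fun x => (f : Fun n 2) (point 0 x)) x =
        (Pd (.x i) (Pd (.x i) f) : Fun n 2) (point 0 x) := by
      intro i
      rw [← pd_comp_point]
      congr 1
      exact funext fun x => pd_comp_point f 0 i x
    have h4 := congrArg (fun f : DiffFun n 2 => (f : Fun n 2) (point 0 x)) h1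
    simp only [hu.lap_apply, DiffFun.add_apply, DiffFun.mul_apply, DiffFun.sum_apply,
      DiffFun.algebraMap_apply, DiffFun.zero_apply] at h4
    simpa only [h3] using h4
  · rw [hk k]
    exact DiffFun.ext fun p => eq_mul_exp_of_Pd_t hu ht p

end Brusselator

end

/-! ### The theorem -/

open Brusselator in
theorem mainTheorem7 (n : ℕ) (hn : 1 ≤ n) (a b c : ℝ) (hc : c ≠ 0) :
    (c ≠ 1 →
      (∀ G : (Fin n → ℝ) → ℝ, Brusselator.IsProfile c G →
        (∃ H : Fin n → (Fin n → ℝ) → ℝ, Brusselator.IsAntiderivatives G H) ∧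
        ∀ H : Fin n → (Fin n → ℝ) → ℝ, Brusselator.IsAntiderivatives G H →
          Brusselator.IsConservedCurrent (Brusselator.rhs n a b c)
            (Brusselator.current a c G H) ∧
          ∀ (k : Fin 2) (p : Brusselator.Coord n 2 → ℝ),
            Brusselator.characteristic (Brusselator.current a c G H) k p =
              G (Brusselator.space p) * Real.exp (c * p .t / (c - 1))) ∧
      (∀ J : Fin (n + 1) → Brusselator.Fun n 2,
        Brusselator.IsConservedCurrent (Brusselator.rhs n a b c) J →
        ∃ G : (Fin n → ℝ) → ℝ, Brusselator.IsProfile c G ∧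
          (∀ (k : Fin 2) (p : Brusselator.Coord n 2 → ℝ),
            Brusselator.characteristic J k p =
              G (Brusselator.space p) * Real.exp (c * p .t / (c - 1))) ∧
          ∀ H : Fin n → (Fin n → ℝ) → ℝ, Brusselator.IsAntiderivatives G H →
            Brusselator.CurrentEquiv (Brusselator.rhs n a b c) J
              (Brusselator.current a c G H))) ∧
    (c = 1 →
      ∀ J : Fin (n + 1) → Brusselator.Fun n 2,
        Brusselator.IsConservedCurrent (Brusselator.rhs n a b c) J →
        Brusselator.IsTrivialCurrent (Brusselator.rhs n a b c) J) := by
  have hchar : ∀ (G : (Fin n → ℝ) → ℝ) (hG : ContDiff ℝ ∞ G) (p : Coord n 2 → ℝ),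
      ((ofSpace G hG * expT n 2 (c / (c - 1)) : DiffFun n 2) : Fun n 2) p =
        G (space p) * Real.exp (c * p .t / (c - 1)) := by
    intro G hG p
    rw [DiffFun.mul_apply, ofSpace_apply, expT_apply, div_mul_eq_mul_div]
  rw [← coe_rhsD]
  refine ⟨fun hc1 => ⟨fun G hG => ⟨exists_isAntiderivatives hG.1, fun H hH => ?_⟩,
    fun J hJ => ?_⟩, ?_⟩
  · rw [← coe_currentD a c G H hG.1 hH]
    refine ⟨(isConservedCurrent_iff _ _).2 (conserved_currentD hn a b hc1 hG hH), fun k p => ?_⟩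
    rw [characteristic_eq_euler, euler_currentD, hchar]
  · obtain ⟨J, rfl⟩ : ∃ J' : Fin (n + 1) → DiffFun n 2, J = fun k => (J' k : Fun n 2) :=
      ⟨fun k => ⟨J k, hJ.1 k⟩, rfl⟩
    rw [isConservedCurrent_iff] at hJ
    obtain ⟨G, hG, he⟩ := exists_profile hn hc hc1 hJ
    refine ⟨G, hG, fun k p => by rw [characteristic_eq_euler, he, hchar], fun H hH => ?_⟩
    rw [CurrentEquiv, ← coe_currentD a c G H hG.1 hH]
    refine isTrivialCurrent_of_euler _ hn (J - currentD a c G H hG.1 hH)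
      ((isConservedCurrent_iff _ _).2 ?_) fun k => ?_
    · have h1 := conserved_currentD hn a b hc1 hG hH
      simp only [Pi.sub_apply, map_sub, Finset.sum_sub_distrib]
      linear_combination hJ - h1
    · rw [Pi.sub_apply, map_sub, he, euler_currentD, sub_self]
  · rintro rfl J hJ
    obtain ⟨J, rfl⟩ : ∃ J' : Fin (n + 1) → DiffFun n 2, J = fun k => (J' k : Fun n 2) :=
      ⟨fun k => ⟨J k, hJ.1 k⟩, rfl⟩
    refine isTrivialCurrent_of_euler _ hn J hJ fun k => ?_
    rw [isConservedCurrent_iff] at hJ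
    obtain ⟨hk, -, h1, -⟩ := euler_of_conserved hn hc hJ
    rw [hk k]
    -- For c = 1 the equation χ + (c-1)Δχ = 0 reads χ = 0.
    simpa using h1
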